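/- **Setting.** Let $D\subseteq\mathbb R^k$ be open, $\Omega\subset\mathbb R^d$ compact, $x_1,\dots,x_n\in\Omega$ ($n\ge1$) data points, $\hat\nu=\frac1n\sum_{l}\delta_{x_l}$, $\|h\|_{\hat\nu}^2=\int|h|^2d\hat\nu$, $f_*:\Omega\to\mathbb R$ a target, and $\lambda\in\mathbb R$. Let $\varphi:D\times\Omega\to\mathbb R$ be twice differentiable in $\theta$ with $\nabla_\theta\nabla_\theta\varphi(\theta,x)$ Lipschitz in $\theta$, uniformly in $x$, and let $r:D\to\mathbb R$ be $C^2$. Put $$F(\theta)=\int f_*(x)\varphi(\theta,x)\,\hat\nu(dx)-\lambda r(\theta),\qquad K(\theta,\theta')=\int\varphi(\theta,x)\varphi(\theta',x)\,\hat\nu(dx),$$ $$V(\theta,\mu)=-F(\theta)+\int K(\theta,\theta')\,\mu(d\theta'),\qquad f[\mu]=\int\varphi(\theta,\cdot)\,\mu(d\theta),$$ $$\mathcal L(\mu)=\tfrac12\|f[\mu]-f_*\|_{\hat\nu}^2+\lambda\int r\,d\mu,\qquad \mathcal E(\Theta)=-\int F(\Theta(\theta))\mu_0(d\theta)+\tfrac12\iint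 K(\Theta(\theta),\Theta(\theta'))\mu_0(d\theta)\mu_0(d\theta').$$ Let $\mu_0$ be a compactly supported probability measure on $D$. Suppose that the mean-field flow $\dot\Theta_t(\theta)=-\nabla V(\Theta_t(\theta),\mu_t)$, $\Theta_0(\theta)=\theta$, $\mu_t=(\Theta_t)_\#\mu_0$, exists in $D$ for all $t\ge0$ and $\theta\in\operatorname{supp}\mu_0$ (jointly continuous in $(t,\theta)$) and that $\Theta_t\to\Theta_\infty$ $\mu_0$-almost surely as $t\to\infty$. Let $\mu_\infty=(\Theta_\infty)_\#\mu_0$ and $f_\infty=f[\mu_\infty]$. Let $\omega_0$ be the centred Gaussian random linear functional on continuous functions on $\operatorname{supp}\mu_0$ with covariance $\mathbb E_0[\omega_0(d\theta)\omega_0(d\theta')]=\mu_0(d\theta)\delta_\theta(d\theta')-\mu_0(d\theta)\mu_0(d\theta')$. Let $T_t$ be the (jointly continuous in $(t,\theta)$, for almost every realization of $\omega_0$) solution on $\operatorname{supp}\mu_0$ of $$\dot T_t(\theta)=-\nabla\nabla V(\Theta_t(\theta),\mu_t)T_t(\theta)-\int\nabla\nabla'K(\Theta_t(\theta),\Theta_t(\theta'))T_t(\theta')\mu_0(d\theta')-\int\nabla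 K(\Theta_t(\theta),\Theta_t(\theta'))\omega_0(d\theta'),\quad T_0=0,$$ where $\nabla\nabla V$ is the Hessian in $\theta$, and let $$g_t=\int\varphi(\Theta_t(\theta),\cdot)\,\omega_0(d\theta)+\int\nabla\varphi(\Theta_t(\theta),\cdot)\cdot T_t(\theta)\,\mu_0(d\theta).$$ **Theorem.** Suppose that $\mu_0=\mu_\infty$ and that $\Theta_\infty$ is a local minimizer of $\mathcal E$: for some $\varepsilon>0$, $\mathcal E(\Theta_\infty)\le\mathcal E(\Theta)$ for all measurable $\Theta$ with values in $D$ and $|\Theta-\Theta_\infty|\le\varepsilon$ $\mu_0$-almost everywhere. Suppose moreover that either $\mu_\infty$ has no atoms, or $\mu_\infty$ is a local minimizer of $\mathcal L$ among probability measures on $D$: for some $\varepsilon>0$, $\mathcal L(\mu_\infty)\le\mathcal L(\rho)$ for each probability measure $\rho$ on $D$ obtained from $\mu_\infty$ by a transport plan that moves mass by at most $\varepsilon$ (and may split atoms). Then $\mathbb E_0\|g_t\|_{\hat\nu}^2$ is finite for every $t\ge0$ and integrable on bounded time intervals, the limit below exists, and $$\lim_{T\to\infty}\frac1T\int_0^T\mathbb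 E_0\|g_t\|_{\hat\nu}^2\,dt\;\le\;\int_D\|\varphi(\theta,\cdot)\|_{\hat\nu}^2\,\mu_\infty(d\theta)-\|f_\infty\|_{\hat\nu}^2 .$$ -/

import Mathlib

open MeasureTheory ProbabilityTheory Filter Topology Set
open scoped NNReal ENNReal

noncomputable section

/-- Euclidean space of dimension `k`. -/
abbrev Euc (k : ℕ) : Type := EuclideanSpace ℝ (Fin k)

/-- The Hessian `∇∇f(θ)`, as the derivative of the gradient. -/
def hess {k : ℕ} (f : Euc k → ℝ) (θ : Euc k) : Euc k →L[ℝ] Euc k :=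
  fderiv ℝ (gradient f) θ

/-- The data of a regularized least-squares problem over models `(1/m) ∑ᵢ φ(θᵢ, ·)`:
parameter domain `D`, data space `Om`, unit `phi`, regularizer `r` with strength `lam`,
target `fstar`, and the data points `x₁, …, xₙ`. -/
structure Problem (k d n : ℕ) where
  D : Set (Euc k)
  Om : Set (Euc d)
  phi : Euc k → Euc d → ℝ
  r : Euc k → ℝ
  lam : ℝ
  fstar : Euc d → ℝ
  x : Fin n → Euc d

namespace Problem

variable {k d n : ℕ} (Q : Problem k d n)

/-- Standing regularity assumptions. Only values on `D` matter. -/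
structure Regular : Prop where
  isOpen_D : IsOpen Q.D
  isCompact_Om : IsCompact Q.Om
  data_mem : ∀ l, Q.x l ∈ Q.Om
  phi_diff : ∀ x ∈ Q.Om, DifferentiableOn ℝ (fun θ => Q.phi θ x) Q.D
  grad_phi_diff : ∀ x ∈ Q.Om, DifferentiableOn ℝ (gradient fun θ => Q.phi θ x) Q.D
  hess_phi_lipschitz : ∃ L : ℝ≥0, ∀ x ∈ Q.Om,
    LipschitzOnWith L (hess fun θ => Q.phi θ x) Q.D
  r_smooth : ContDiffOn ℝ 2 Q.r Q.D

/-- The empirical data measure `ν̂ = (1/n) ∑ₗ δ_{xₗ}`. -/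
def nu : Measure (Euc d) := (n : ℝ≥0∞)⁻¹ • ∑ l, Measure.dirac (Q.x l)

/-- `‖h‖²_ν̂`. -/
def normSq (h : Euc d → ℝ) : ℝ := ∫ x, (h x) ^ 2 ∂Q.nu

/-- The function represented by a measure, `f[m] = ∫ φ(θ, ·) m(dθ)`. -/
def f (m : Measure (Euc k)) (x : Euc d) : ℝ := ∫ θ, Q.phi θ x ∂m

/-- The loss `½ ‖f[m] - f_*‖²_ν̂ + λ ∫ r dm`. -/
def loss (m : Measure (Euc k)) : ℝ :=
  (1 / 2) * Q.normSq (fun x => Q.f m x - Q.fstar x) + Q.lam * ∫ θ, Q.r θ ∂m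

/-- `F(θ) = ∫ f_*(x) φ(θ, x) ν̂(dx) - λ r(θ)`. -/
def F (θ : Euc k) : ℝ := (∫ x, Q.fstar x * Q.phi θ x ∂Q.nu) - Q.lam * Q.r θ

/-- `K(θ, θ') = ∫ φ(θ, x) φ(θ', x) ν̂(dx)`. -/
def K (θ θ' : Euc k) : ℝ := ∫ x, Q.phi θ x * Q.phi θ' x ∂Q.nu

/-- `∇K(θ, θ')`: gradient in the first variable. -/
def gradK (θ θ' : Euc k) : Euc k := gradient (fun η => Q.K η θ') θ

/-- `∇∇K(θ, θ')`: Hessian in the first variable. -/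
def hessK (θ θ' : Euc k) : Euc k →L[ℝ] Euc k := hess (fun η => Q.K η θ') θ

/-- `∇∇'K(θ, θ')`: derivative in the second variable of the gradient in the first one. -/
def mixedK (θ θ' : Euc k) : Euc k →L[ℝ] Euc k := fderiv ℝ (fun η => Q.gradK θ η) θ'

/-- `∇V(θ, μ) = -∇F(θ) + ∫ ∇K(θ, Θ(θ')) μ₀(dθ')` where `μ` is the image of `μ₀` under `Θ`. -/
def gradV (μ₀ : Measure (Euc k)) (Θ : Euc k → Euc k) (θ : Euc k) : Euc k :=
  -gradient Q.F θ + ∫ θ', Q.gradK θ (Θ θ') ∂μ₀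

/-- `∇∇V(θ, μ) = -∇∇F(θ) + ∫ ∇∇K(θ, Θ(θ')) μ₀(dθ')` where `μ` is the image of `μ₀`
under `Θ`. -/
def hessV (μ₀ : Measure (Euc k)) (Θ : Euc k → Euc k) (θ : Euc k) : Euc k →L[ℝ] Euc k :=
  -hess Q.F θ + ∫ θ', Q.hessK θ (Θ θ') ∂μ₀

/-- The energy `-∫ F(Θ(θ)) μ₀(dθ) + ½ ∬ K(Θ(θ), Θ(θ')) μ₀(dθ) μ₀(dθ')` of a map `Θ`. -/
def energy (μ₀ : Measure (Euc k)) (Θ : Euc k → Euc k) : ℝ :=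
  -(∫ θ, Q.F (Θ θ) ∂μ₀) + (1 / 2) * ∫ θ, ∫ θ', Q.K (Θ θ) (Θ θ') ∂μ₀ ∂μ₀

/-- The characteristic flow started from `μ₀`, for all nonnegative times, on the support
of `μ₀`: a jointly continuous solution in `D` of `dΘ/dt = -∇V(Θ, μ_t)`, `Θ₀ = id`. -/
structure IsCharFlow (μ₀ : Measure (Euc k)) (Θ : ℝ → Euc k → Euc k) : Prop where
  cont : ContinuousOn (fun p : ℝ × Euc k => Θ p.1 p.2) (Ici 0 ×ˢ μ₀.support)
  mem : ∀ t, 0 ≤ t → ∀ θ ∈ μ₀.support, Θ t θ ∈ Q.D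
  init : ∀ θ ∈ μ₀.support, Θ 0 θ = θ
  ode : ∀ θ ∈ μ₀.support, ∀ t, 0 ≤ t →
    HasDerivWithinAt (fun s => Θ s θ) (-Q.gradV μ₀ (Θ t) (Θ t θ)) (Ici 0) t

/-- `Θ` is a local minimizer of the energy among the measurable maps into `D`, in the uniform
(`L^∞(μ₀)`) sense. Since `μ₀` is a probability measure, every local minimizer with respect
to the `L²(μ₀)` norm is one. -/
def IsLocalMinMap (μ₀ : Measure (Euc k)) (Θ : Euc k → Euc k) : Prop :=
  ∃ ε > 0, ∀ Θ' : Euc k → Euc k, Measurable Θ' → (∀ᵐ θ ∂μ₀, Θ' θ ∈ Q.D) →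
    (∀ᵐ θ ∂μ₀, dist (Θ' θ) (Θ θ) ≤ ε) → Q.energy μ₀ Θ ≤ Q.energy μ₀ Θ'

/-- `μ` is a local minimizer of the loss among the probability measures on `D`, for the
transport distance `W_∞`: `γ` is a transport plan from `μ` that moves mass by at most `ε`,
and mass sitting at one point may be split. -/
def IsLocalMinMeasure (μ : Measure (Euc k)) : Prop :=
  ∃ ε > 0, ∀ γ : Measure (Euc k × Euc k), γ.fst = μ → (∀ᵐ p ∂γ, p.2 ∈ Q.D) →
    (∀ᵐ p ∂γ, dist p.2 p.1 ≤ ε) → Q.loss μ ≤ Q.loss γ.snd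

end Problem

/-- `∫ χ dw` for a linear functional `w` on the continuous functions on `S`. -/
def testInt {S : Type*} [TopologicalSpace S] (w : C(S, ℝ) →ₗ[ℝ] ℝ) (χ : S → ℝ) : ℝ :=
  open Classical in if h : Continuous χ then w ⟨χ, h⟩ else 0

/-- `∫ χ dw`, componentwise, for a vector-valued test function `χ`. -/
def testIntVec {S : Type*} [TopologicalSpace S] {k : ℕ} (w : C(S, ℝ) →ₗ[ℝ] ℝ)
    (χ : S → Euc k) : Euc k :=
  WithLp.toLp 2 fun i => testInt w fun s => χ s i

/-- `ω₀` is a centred Gaussian random linear functional on the continuous test functions on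
the support of `μ₀`, with covariance `μ₀(dθ) δ_θ(dθ') - μ₀(dθ) μ₀(dθ')`. -/
structure IsInitialFluctuation {k : ℕ} {Ξ : Type*} [MeasurableSpace Ξ] (P : Measure Ξ)
    (μ₀ : Measure (Euc k)) (ω₀ : Ξ → C(μ₀.support, ℝ) →ₗ[ℝ] ℝ) : Prop where
  gaussian : IsGaussianProcess (fun (χ : C(μ₀.support, ℝ)) ξ => ω₀ ξ χ) P
  mean : ∀ χ, ∫ ξ, ω₀ ξ χ ∂P = 0
  covariance : ∀ χ ψ, ∫ ξ, ω₀ ξ χ * ω₀ ξ ψ ∂P =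
    (∫ θ, χ θ * ψ θ ∂(μ₀.comap Subtype.val)) -
      (∫ θ, χ θ ∂(μ₀.comap Subtype.val)) * ∫ θ, ψ θ ∂(μ₀.comap Subtype.val)

namespace Problem

variable {k d n : ℕ} (Q : Problem k d n)

/-- For one realization `w` of the initial fluctuation, `T` is the flow of the linearized
dynamics: the jointly continuous solution on the support of `μ₀` of
`dT/dt(θ) = -∇∇V(Θ_t(θ), μ_t) T_t(θ) - ∫ ∇∇'K(Θ_t(θ), Θ_t(θ')) T_t(θ') μ₀(dθ')
- ∫ ∇K(Θ_t(θ), Θ_t(θ')) w(dθ')` with `T₀ = 0`. -/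
structure IsTangentFlow (μ₀ : Measure (Euc k)) (Θ : ℝ → Euc k → Euc k)
    (w : C(μ₀.support, ℝ) →ₗ[ℝ] ℝ) (T : ℝ → Euc k → Euc k) : Prop where
  cont : ContinuousOn (fun p : ℝ × Euc k => T p.1 p.2) (Ici 0 ×ˢ μ₀.support)
  init : ∀ θ ∈ μ₀.support, T 0 θ = 0
  ode : ∀ θ ∈ μ₀.support, ∀ t, 0 ≤ t →
    HasDerivWithinAt (fun s => T s θ)
      (-(Q.hessV μ₀ (Θ t) (Θ t θ) (T t θ))
        - (∫ θ', Q.mixedK (Θ t θ) (Θ t θ') (T t θ') ∂μ₀)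
        - testIntVec w (fun θ' => Q.gradK (Θ t θ) (Θ t θ'))) (Ici 0) t

/-- The fluctuation of the represented function,
`g_t(x) = ∫ φ(Θ_t(θ), x) w(dθ) + ∫ ∇φ(Θ_t(θ), x) · T_t(θ) μ₀(dθ)`,
for one realization `w` of the initial fluctuation. -/
def g (μ₀ : Measure (Euc k)) (Θ : ℝ → Euc k → Euc k)
    (w : C(μ₀.support, ℝ) →ₗ[ℝ] ℝ) (T : ℝ → Euc k → Euc k) (t : ℝ) (x : Euc d) : ℝ :=
  testInt w (fun θ => Q.phi (Θ t θ) x) +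
    ∫ θ, inner ℝ (gradient (fun η => Q.phi η x) (Θ t θ)) (T t θ) ∂μ₀

end Problem

end

/-!
Let `S` be the support of `μ₀`. Since `Θinf` preserves `μ₀`, composing with it does not change the
energy of a map, so local minimality of `Θinf` is local minimality of the identity
(`Problem.Regular.exists_energy_id_le`). The energy and the loss are quadratic functionals of
finitely many integrals; around `μ₀` they are expanded exactly as the increment of the potential
`V(·, μ₀)` plus half the squared change of the represented function
(`Problem.Regular.energy_sub_energy_id`, `Problem.Regular.loss_sub_loss`).

The first-order condition is `∇V = 0` on `S` (`Problem.Regular.gradient_potential_eq_zero`). Hence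
the identity solves the characteristic equation, and by uniqueness the flow does not move
(`Problem.IsCharFlow.eq_self`). The second-order condition only gives positivity of the sum of the
Hessian term and the interaction term, but the two can be separated. Without atoms, shifting a small
ball of mass `m` by `s` changes the Hessian term by order `m s²` and the interaction term by order
`m² s²`. With splitting, shifting the two halves of a ball in opposite directions makes the
interaction term of order `s⁴`. In both cases `∇∇V ≥ 0` on `S`.

The tangent flow is therefore the autonomous gradient flow, started from `0`, of the convex
quadratic energy `Φ(T) = ½ ∫ ⟨∇∇V T, T⟩ dμ₀ + ½ ‖g‖²`, where `g = b + ∫ ∇φ · T dμ₀` and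
`b = ∫ φ dω₀`. The energy decreases and its Hessian part is nonnegative, so `‖g_t‖² ≤ ‖b‖²` for each
realization (`IsLinearizedFlow.sum_response_sq_le`). The energy tends to its infimum and is uniformly
convex in `g`, so `g_t` converges for each realization (`IsLinearizedFlow.exists_tendsto_response`).
Dominated convergence gives the limit of `𝔼 ‖g_t‖²` and of its time averages, bounded by `𝔼 ‖b‖²`,
which the covariance of `ω₀` identifies with the right-hand side. Measurability in the realization
is not assumed of the tangent flow; it holds because differences of solutions are again solutions, so
that `‖g_t‖` is a `1`-Lipschitz function of the Gaussian vector `b`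
(`aestronglyMeasurable_of_dist_le`).
-/

noncomputable section

/-! ### Second-order calculus on an open set -/

section Calculus

variable {k : ℕ} {D S : Set (Euc k)} {f g : Euc k → ℝ} {θ : Euc k}

/-- Twice differentiable with continuous Hessian is `C²`. -/
lemma contDiffOn_two_of_gradient (hD : IsOpen D) (h1 : DifferentiableOn ℝ f D)
    (h2 : DifferentiableOn ℝ (gradient f) D) (h3 : ContinuousOn (hess f) D) :
    ContDiffOn ℝ 2 f D := by
  have hg : ContDiffOn ℝ 1 (gradient f) D := by
    rw [show (1 : WithTop ℕ∞) = 0 + 1 by simp, contDiffOn_succ_iff_fderiv_of_isOpen hD]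
    exact ⟨h2, by simp, contDiffOn_zero.2 h3⟩
  rw [show (2 : WithTop ℕ∞) = 1 + 1 by norm_num, contDiffOn_succ_iff_fderiv_of_isOpen hD]
  refine ⟨h1, by simp, ?_⟩
  rw [← toDual_comp_gradient]
  exact (InnerProductSpace.toDual ℝ (Euc k)).toContinuousLinearEquiv.contDiff.comp_contDiffOn hg

lemma ContDiffOn.gradient_one (hf : ContDiffOn ℝ 2 f D) (hD : IsOpen D) :
    ContDiffOn ℝ 1 (gradient f) D := by
  rw [show (2 : WithTop ℕ∞) = 1 + 1 by norm_num, contDiffOn_succ_iff_fderiv_of_isOpen hD] at hf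
  exact (InnerProductSpace.toDual ℝ (Euc k)).symm.toContinuousLinearEquiv.contDiff.comp_contDiffOn
    hf.2.2

lemma ContDiffOn.continuousOn_hess (hf : ContDiffOn ℝ 2 f D) (hD : IsOpen D) :
    ContinuousOn (hess f) D :=
  (hf.gradient_one hD).continuousOn_fderiv_of_isOpen hD le_rfl

lemma ContDiffOn.hasGradientAt (hf : ContDiffOn ℝ 2 f D) (hD : IsOpen D) (hθ : θ ∈ D) :
    HasGradientAt f (gradient f θ) θ :=
  ((hf.contDiffAt (hD.mem_nhds hθ)).differentiableAt (by norm_num)).hasGradientAt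

lemma ContDiffOn.hasFDerivAt_gradient (hf : ContDiffOn ℝ 2 f D) (hD : IsOpen D) (hθ : θ ∈ D) :
    HasFDerivAt (gradient f) (hess f θ) θ :=
  (((hf.gradient_one hD).contDiffAt (hD.mem_nhds hθ)).differentiableAt (by norm_num)).hasFDerivAt

/-- Symmetry of the Hessian. -/
lemma inner_hess_left (hf : ContDiffOn ℝ 2 f D) (hD : IsOpen D) (hθ : θ ∈ D)
    (v w : Euc k) : inner ℝ (hess f θ v) w = inner ℝ v (hess f θ w) := by
  have hsym : IsSymmSndFDerivAt ℝ f θ :=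
    (hf.contDiffAt (hD.mem_nhds hθ)).isSymmSndFDerivAt (by simp)
  have key : ∀ v w : Euc k, fderiv ℝ (fderiv ℝ f) θ v w = inner ℝ (hess f θ v) w := by
    intro v w
    have h1 : HasFDerivAt (fun η => inner ℝ (gradient f η) w)
        ((fderiv ℝ (fderiv ℝ f) θ).flip w) θ := by
      simp only [inner_gradient_left]
      have hd : DifferentiableAt ℝ (fderiv ℝ f) θ :=
        ((hf.contDiffAt (hD.mem_nhds hθ)).fderiv_right (m := 1) (by norm_num)).differentiableAt
          (by norm_num)
      simpa using hd.hasFDerivAt.clm_apply (hasFDerivAt_const w θ)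
    have h2 := (hf.hasFDerivAt_gradient hD hθ).inner ℝ (hasFDerivAt_const w θ)
    simpa using DFunLike.congr_fun (h1.unique h2) v
  rw [← key, hsym v w, key, real_inner_comm]

lemma ContDiffOn.gradient_add (hf : ContDiffOn ℝ 2 f D) (hg : ContDiffOn ℝ 2 g D)
    (hD : IsOpen D) (hθ : θ ∈ D) :
    gradient (fun η => f η + g η) θ = gradient f θ + gradient g θ := by
  refine HasGradientAt.gradient ?_
  rw [hasGradientAt_iff_hasFDerivAt, map_add]
  exact (hf.hasGradientAt hD hθ).hasFDerivAt.add (hg.hasGradientAt hD hθ).hasFDerivAt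

lemma ContDiffOn.gradient_const_mul (hf : ContDiffOn ℝ 2 f D) (c : ℝ)
    (hD : IsOpen D) (hθ : θ ∈ D) :
    gradient (fun η => c * f η) θ = c • gradient f θ := by
  refine HasGradientAt.gradient ?_
  rw [hasGradientAt_iff_hasFDerivAt, map_smul]
  exact (hf.hasGradientAt hD hθ).hasFDerivAt.const_mul c

lemma gradient_sum_mul {ι : Type*} {s : Finset ι} {F : ι → Euc k → ℝ} (c : ι → ℝ)
    (hF : ∀ i, ContDiffOn ℝ 2 (F i) D) (hD : IsOpen D) (hθ : θ ∈ D) :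
    gradient (fun η => ∑ i ∈ s, c i * F i η) θ = ∑ i ∈ s, c i • gradient (F i) θ := by
  refine HasGradientAt.gradient ?_
  rw [hasGradientAt_iff_hasFDerivAt, map_sum]
  refine HasFDerivAt.fun_sum fun i _ => ?_
  rw [map_smul]
  exact ((hF i).hasGradientAt hD hθ).hasFDerivAt.const_mul (c i)

lemma ContDiffOn.hess_add (hf : ContDiffOn ℝ 2 f D) (hg : ContDiffOn ℝ 2 g D)
    (hD : IsOpen D) (hθ : θ ∈ D) :
    hess (fun η => f η + g η) θ = hess f θ + hess g θ := by
  refine HasFDerivAt.fderiv ?_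
  refine ((hf.hasFDerivAt_gradient hD hθ).add
    (hg.hasFDerivAt_gradient hD hθ)).congr_of_eventuallyEq ?_
  filter_upwards [hD.mem_nhds hθ] with η hη using hf.gradient_add hg hD hη

lemma ContDiffOn.hess_const_mul (hf : ContDiffOn ℝ 2 f D) (c : ℝ)
    (hD : IsOpen D) (hθ : θ ∈ D) :
    hess (fun η => c * f η) θ = c • hess f θ := by
  refine HasFDerivAt.fderiv ?_
  refine ((hf.hasFDerivAt_gradient hD hθ).const_smul c).congr_of_eventuallyEq ?_
  filter_upwards [hD.mem_nhds hθ] with η hη using hf.gradient_const_mul c hD hη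

lemma hess_sum_mul {ι : Type*} {s : Finset ι} {F : ι → Euc k → ℝ} (c : ι → ℝ)
    (hF : ∀ i, ContDiffOn ℝ 2 (F i) D) (hD : IsOpen D) (hθ : θ ∈ D) :
    hess (fun η => ∑ i ∈ s, c i * F i η) θ = ∑ i ∈ s, c i • hess (F i) θ := by
  refine HasFDerivAt.fderiv ?_
  refine (HasFDerivAt.fun_sum fun i (_ : i ∈ s) =>
    ((hF i).hasFDerivAt_gradient hD hθ).const_smul (c i)).congr_of_eventuallyEq ?_
  filter_upwards [hD.mem_nhds hθ] with η hη using gradient_sum_mul c hF hD hη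

/-- First- and second-order Taylor bounds, uniform over base points in a compact set. -/
lemma exists_taylor_bounds (hf : ContDiffOn ℝ 2 f D) (hD : IsOpen D) (hS : IsCompact S)
    {δ : ℝ} (hδ : Metric.cthickening δ S ⊆ D) :
    ∃ C, 0 ≤ C ∧ ∀ θ ∈ S, ∀ v : Euc k, ‖v‖ ≤ δ →
      |f (θ + v) - f θ| ≤ C * ‖v‖ ∧ |f (θ + v) - f θ - inner ℝ (gradient f θ) v| ≤ C * ‖v‖ ^ 2 := by
  have hK : IsCompact (Metric.cthickening δ S) := hS.cthickening
  obtain ⟨C₁, hC₁⟩ := hK.exists_bound_of_continuousOn ((hf.gradient_one hD).continuousOn.mono hδ)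
  obtain ⟨C₂, hC₂⟩ := hK.exists_bound_of_continuousOn ((hf.continuousOn_hess hD).mono hδ)
  refine ⟨max (max C₁ C₂) 0, le_max_right _ _, fun θ hθ v hv => ?_⟩
  have hball : ∀ η ∈ Metric.closedBall θ ‖v‖, η ∈ Metric.cthickening δ S := fun η hη =>
    Metric.closedBall_subset_cthickening hθ δ (Metric.closedBall_subset_closedBall hv hη)
  have hconv : Convex ℝ (Metric.closedBall θ ‖v‖) := convex_closedBall _ _
  have h0 : θ ∈ Metric.closedBall θ ‖v‖ := Metric.mem_closedBall_self (norm_nonneg _)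
  have hv' : θ + v ∈ Metric.closedBall θ ‖v‖ := by simp
  have hgrad : ∀ η ∈ Metric.closedBall θ ‖v‖, ‖gradient f η - gradient f θ‖ ≤ C₂ * ‖v‖ := by
    intro η hη
    refine (hconv.norm_image_sub_le_of_norm_hasFDerivWithin_le
      (fun x hx => (hf.hasFDerivAt_gradient hD (hδ (hball x hx))).hasFDerivWithinAt)
      (fun x hx => hC₂ x (hball x hx)) h0 hη).trans ?_
    have : 0 ≤ C₂ := (norm_nonneg _).trans (hC₂ θ (hball θ h0))
    gcongr
    simpa [dist_eq_norm] using hη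
  constructor
  · have := hconv.norm_image_sub_le_of_norm_hasFDerivWithin_le (f := f) (C := C₁)
      (fun x hx => (hf.hasGradientAt hD (hδ (hball x hx))).hasFDerivAt.hasFDerivWithinAt)
      (fun x hx => (LinearIsometryEquiv.norm_map _ _).trans_le (hC₁ x (hball x hx))) h0 hv'
    simp only [Real.norm_eq_abs, add_sub_cancel_left] at this
    exact this.trans (by gcongr; exact (le_max_left _ _).trans (le_max_left _ _))
  · have := hconv.norm_image_sub_le_of_norm_hasFDerivWithin_le (C := C₂ * ‖v‖)
      (f := fun η => f η - inner ℝ (gradient f θ) η)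
      (f' := fun η => InnerProductSpace.toDual ℝ (Euc k) (gradient f η - gradient f θ))
      (fun x hx => by
        rw [map_sub]
        exact ((hf.hasGradientAt hD (hδ (hball x hx))).hasFDerivAt.sub
          (InnerProductSpace.toDual ℝ (Euc k) (gradient f θ)).hasFDerivAt).hasFDerivWithinAt)
      (fun x hx => (LinearIsometryEquiv.norm_map _ _).trans_le (hgrad x hx)) h0 hv'
    simp only [Real.norm_eq_abs, add_sub_cancel_left, inner_add_right] at this
    calc _ = _ := by congr 1; ring
      _ ≤ _ := this
      _ = C₂ * ‖v‖ ^ 2 := by ring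
      _ ≤ _ := by gcongr; exact (le_max_right _ _).trans (le_max_left _ _)

/-- A direction of negative curvature at one point gives a uniform quadratic decrease, beyond the
linear term, at all nearby points. -/
lemma exists_quadratic_decrease (hf : ContDiffOn ℝ 2 f D) (hD : IsOpen D) (hθ : θ ∈ D)
    {v : Euc k} (hv : inner ℝ (hess f θ v) v < 0) :
    ∃ c > 0, ∃ δ > 0, ∀ η ∈ Metric.ball θ δ, ∀ s : ℝ, |s| ≤ δ →
      f (η + s • v) ≤ f η + s * inner ℝ (gradient f η) v - c * s ^ 2 := by
  have hv0 : 0 < ‖v‖ := by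
    rw [norm_pos_iff]; rintro rfl; simp at hv
  set a := -inner ℝ (hess f θ v) v with ha
  have ha0 : 0 < a := by simpa [ha] using hv
  set e := a / (4 * ‖v‖ ^ 2) with he
  have he0 : 0 < e := by positivity
  have hstrict : HasStrictFDerivAt (gradient f) (hess f θ) θ :=
    ((hf.gradient_one hD).contDiffAt (hD.mem_nhds hθ)).hasStrictFDerivAt (by norm_num)
  have hev := hstrict.isLittleO.def he0
  have hev2 : ∀ᶠ p : Euc k × Euc k in 𝓝 (θ, θ), p.1 ∈ D :=
    continuous_fst.continuousAt.eventually_mem (hD.mem_nhds hθ)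
  obtain ⟨ρ, hρ, hρ'⟩ := Metric.eventually_nhds_iff_ball.1 (hev.and hev2)
  have hδ0 : 0 < ρ / (2 * (1 + ‖v‖)) := by positivity
  refine ⟨a / 4, by positivity, ρ / (2 * (1 + ‖v‖)), hδ0, fun η hη s hs => ?_⟩
  have hδρ : ρ / (2 * (1 + ‖v‖)) * (1 + ‖v‖) = ρ / 2 := by field_simp
  set δ := ρ / (2 * (1 + ‖v‖))
  have hmem : ∀ u : ℝ, |u| ≤ |s| → (η + u • v, η) ∈ Metric.ball (θ, θ) ρ := by
    intro u hu
    rw [Metric.mem_ball] at hη ⊢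
    rw [Prod.dist_eq, max_lt_iff]
    have h1 : dist (η + u • v) θ ≤ dist η θ + |u| * ‖v‖ := by
      rw [dist_eq_norm, dist_eq_norm, ← Real.norm_eq_abs, ← norm_smul]
      calc _ = ‖η - θ + u • v‖ := by congr 1; abel
        _ ≤ _ := norm_add_le _ _
    have h2 : |u| * ‖v‖ ≤ δ * ‖v‖ := by gcongr; exact hu.trans hs
    have h3 : 0 ≤ δ * ‖v‖ := by positivity
    constructor <;> simp only <;> nlinarith
  -- the remainder `f (η + u v) - u ⟨∇f η, v⟩ - (u² / 2) ⟨H v, v⟩` has small derivative in `u`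
  set R : ℝ → ℝ := fun u => f (η + u • v) - u * inner ℝ (gradient f η) v
    - u ^ 2 / 2 * inner ℝ (hess f θ v) v with hR
  have hRd : ∀ u ∈ Metric.closedBall (0 : ℝ) |s|, HasDerivWithinAt R
      (inner ℝ (gradient f (η + u • v) - gradient f η - hess f θ (u • v)) v)
      (Metric.closedBall (0 : ℝ) |s|) u := by
    intro u hu
    have hu' : |u| ≤ |s| := by simpa using hu
    have hline : HasDerivAt (fun u : ℝ => η + u • v) v u := by
      simpa using ((hasDerivAt_id u).smul_const v).const_add η
    have h1 := (hf.hasGradientAt hD (hρ' _ (hmem u hu')).2).hasFDerivAt.comp_hasDerivAt u hline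
    have h2 := (h1.sub ((hasDerivAt_id u).mul_const (inner ℝ (gradient f η) v))).sub
      ((((hasDerivAt_id u).pow 2).div_const 2).mul_const (inner ℝ (hess f θ v) v))
    refine (h2.congr_deriv ?_).hasDerivWithinAt
    simp only [InnerProductSpace.toDual_apply_apply, inner_sub_left, map_smul, inner_smul_left]
    simp
  have hRb : ∀ u ∈ Metric.closedBall (0 : ℝ) |s|,
      ‖(inner ℝ (gradient f (η + u • v) - gradient f η - hess f θ (u • v)) v : ℝ)‖
        ≤ e * |s| * ‖v‖ ^ 2 := by
    intro u hu
    have hu' : |u| ≤ |s| := by simpa using hu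
    have h1 := (hρ' _ (hmem u hu')).1
    simp only [add_sub_cancel_left, norm_smul, Real.norm_eq_abs] at h1
    calc _ ≤ ‖gradient f (η + u • v) - gradient f η - hess f θ (u • v)‖ * ‖v‖ :=
          norm_inner_le_norm _ _
      _ ≤ (e * (|u| * ‖v‖)) * ‖v‖ := by gcongr
      _ ≤ (e * (|s| * ‖v‖)) * ‖v‖ := by gcongr
      _ = _ := by ring
  have hfin := (convex_closedBall (0 : ℝ) |s|).norm_image_sub_le_of_norm_hasDerivWithin_le
    hRd hRb (Metric.mem_closedBall_self (abs_nonneg s)) (y := s) (by simp)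
  simp only [hR, Real.norm_eq_abs, zero_smul, add_zero, sub_zero] at hfin
  have h4 : e * |s| * ‖v‖ ^ 2 * |s| = a / 4 * s ^ 2 := by
    rw [he, ← sq_abs s]; field_simp
  rw [h4] at hfin
  have := (abs_le.1 hfin).2
  simp only [zero_mul, sub_zero, ne_eq, OfNat.ofNat_ne_zero, not_false_eq_true, zero_pow,
    zero_div] at this
  have h5 : inner ℝ (hess f θ v) v = -a := by simp [ha]
  rw [h5] at this
  nlinarith

end Calculus

/-! ### Integrals over a compact set that depend on time -/

section ParametricIntegral

variable {k : ℕ} {μ : Measure (Euc k)} [IsProbabilityMeasure μ] {S : Set (Euc k)}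

lemma integrable_of_continuousOn_compact {F : Type*} [NormedAddCommGroup F]
    (hS : IsCompact S) (hμ : ∀ᵐ θ ∂μ, θ ∈ S) {q : Euc k → F} (hq : ContinuousOn q S) :
    Integrable q μ := by
  rw [← Measure.restrict_eq_self_of_ae_mem hμ]
  exact hq.integrableOn_compact hS

variable {q q' : ℝ → Euc k → ℝ}

lemma ContinuousOn.slice {F : Type*} [TopologicalSpace F] {q : ℝ → Euc k → F}
    (hq : ContinuousOn (fun p : ℝ × Euc k => q p.1 p.2) (Ici 0 ×ˢ S)) {t : ℝ} (ht : 0 ≤ t) :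
    ContinuousOn (q t) S :=
  hq.comp (f := fun θ => (t, θ)) (by fun_prop) fun _ hθ => ⟨ht, hθ⟩

lemma continuousOn_integral_of_compact (hS : IsCompact S) (hμ : ∀ᵐ θ ∂μ, θ ∈ S)
    (hq : ContinuousOn (fun p : ℝ × Euc k => q p.1 p.2) (Ici 0 ×ˢ S)) :
    ContinuousOn (fun t => ∫ θ, q t θ ∂μ) (Ici 0) := by
  intro t ht
  obtain ⟨C, hC⟩ := ((isCompact_Icc (a := (0 : ℝ)) (b := t + 1)).prod hS).exists_bound_of_continuousOn
    (hq.mono (prod_mono_left fun _ h => h.1))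
  have hev : ∀ᶠ s in 𝓝[Ici 0] t, s ∈ Icc 0 (t + 1) := by
    filter_upwards [self_mem_nhdsWithin, mem_nhdsWithin_of_mem_nhds (Iic_mem_nhds (lt_add_one t))]
      with s h1 h2 using ⟨h1, h2⟩
  refine continuousWithinAt_of_dominated (bound := fun _ => C) ?_ ?_ (integrable_const C) ?_
  · filter_upwards [self_mem_nhdsWithin] with s hs
      using (integrable_of_continuousOn_compact hS hμ (hq.slice hs)).aestronglyMeasurable
  · filter_upwards [hev] with s hs
    filter_upwards [hμ] with θ hθ using hC (s, θ) ⟨hs, hθ⟩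
  · filter_upwards [hμ] with θ hθ
    exact (hq.comp (f := fun s => (s, θ)) (by fun_prop) (fun s hs => ⟨hs, hθ⟩)) t ht

lemma hasDerivAt_integral_of_compact (hS : IsCompact S) (hμ : ∀ᵐ θ ∂μ, θ ∈ S)
    (hq : ContinuousOn (fun p : ℝ × Euc k => q p.1 p.2) (Ici 0 ×ˢ S))
    (hq' : ContinuousOn (fun p : ℝ × Euc k => q' p.1 p.2) (Ici 0 ×ˢ S))
    (hd : ∀ θ ∈ S, ∀ t, 0 ≤ t → HasDerivWithinAt (fun s => q s θ) (q' t θ) (Ici 0) t)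
    {t : ℝ} (ht : 0 < t) :
    HasDerivAt (fun s => ∫ θ, q s θ ∂μ) (∫ θ, q' t θ ∂μ) t := by
  obtain ⟨C, hC⟩ := ((isCompact_Icc (a := (0 : ℝ)) (b := t + 1)).prod hS).exists_bound_of_continuousOn
    (hq'.mono (prod_mono_left fun _ h => h.1))
  refine (hasDerivAt_integral_of_dominated_loc_of_deriv_le (F' := q') (bound := fun _ => C)
    (Ioo_mem_nhds ht (lt_add_one t)) ?_ ?_ ?_ ?_ (integrable_const C) ?_).2
  · filter_upwards [lt_mem_nhds ht] with s hs
      using (integrable_of_continuousOn_compact hS hμ (hq.slice hs.le)).aestronglyMeasurable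
  · exact integrable_of_continuousOn_compact hS hμ (hq.slice ht.le)
  · exact (integrable_of_continuousOn_compact hS hμ (hq'.slice ht.le)).aestronglyMeasurable
  · filter_upwards [hμ] with θ hθ s hs using hC (s, θ) ⟨⟨hs.1.le, hs.2.le⟩, hθ⟩
  · filter_upwards [hμ] with θ hθ s hs
      using (hd θ hθ s hs.1.le).hasDerivAt (Ici_mem_nhds hs.1)

end ParametricIntegral

/-! ### The linearized flow as the gradient flow of a convex quadratic energy -/

section Linearized

variable {k n : ℕ}

/-- The data of a linearized mean-field flow: a probability measure `μ` carried by a compact set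
`S`, a continuous field `H` of positive semidefinite symmetric operators, finitely many continuous
vector fields `a l`, and a weight `c > 0`. -/
structure IsLinearizedSystem (μ : Measure (Euc k)) (S : Set (Euc k)) (c : ℝ)
    (H : Euc k → Euc k →L[ℝ] Euc k) (a : Fin n → Euc k → Euc k) : Prop where
  isProb : IsProbabilityMeasure μ
  isCompact : IsCompact S
  ae_mem : ∀ᵐ θ ∂μ, θ ∈ S
  c_pos : 0 < c
  H_cont : ContinuousOn H S
  H_symm : ∀ θ ∈ S, ∀ v w, inner ℝ (H θ v) w = inner ℝ v (H θ w)
  H_nonneg : ∀ θ ∈ S, ∀ v, 0 ≤ inner ℝ (H θ v) v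
  a_cont : ∀ l, ContinuousOn (a l) S

/-- The value `b + ∫ ⟨a l, y⟩ dμ` of the fluctuation at the `l`-th data point, for the
displacement field `y`. -/
def response (μ : Measure (Euc k)) (a : Fin n → Euc k → Euc k) (b : Fin n → ℝ)
    (y : Euc k → Euc k) (l : Fin n) : ℝ :=
  b l + ∫ θ, inner ℝ (a l θ) (y θ) ∂μ

/-- The convex energy `½ ∫ ⟨H y, y⟩ dμ + (c / 2) ∑ₗ response²`. -/
def quadEnergy (μ : Measure (Euc k)) (c : ℝ) (H : Euc k → Euc k →L[ℝ] Euc k)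
    (a : Fin n → Euc k → Euc k) (b : Fin n → ℝ) (y : Euc k → Euc k) : ℝ :=
  (∫ θ, (1 / 2) * inner ℝ (H θ (y θ)) (y θ) ∂μ) + c / 2 * ∑ l, response μ a b y l ^ 2

/-- Minus the `L²(μ)` gradient of `quadEnergy` at `y`. -/
def quadVelocity (μ : Measure (Euc k)) (c : ℝ) (H : Euc k → Euc k →L[ℝ] Euc k)
    (a : Fin n → Euc k → Euc k) (b : Fin n → ℝ) (y : Euc k → Euc k) (θ : Euc k) : Euc k :=
  -(H θ (y θ)) - c • ∑ l, response μ a b y l • a l θ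

/-- A jointly continuous gradient flow of `quadEnergy`, started from `0`. -/
structure IsLinearizedFlow (μ : Measure (Euc k)) (S : Set (Euc k)) (c : ℝ)
    (H : Euc k → Euc k →L[ℝ] Euc k) (a : Fin n → Euc k → Euc k) (b : Fin n → ℝ)
    (T : ℝ → Euc k → Euc k) : Prop where
  cont : ContinuousOn (fun p : ℝ × Euc k => T p.1 p.2) (Ici 0 ×ˢ S)
  init : ∀ θ ∈ S, T 0 θ = 0
  ode : ∀ θ ∈ S, ∀ t, 0 ≤ t →
    HasDerivWithinAt (fun s => T s θ) (quadVelocity μ c H a b (T t) θ) (Ici 0) t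

variable {μ : Measure (Euc k)} {S : Set (Euc k)} {c : ℝ} {H : Euc k → Euc k →L[ℝ] Euc k}
  {a : Fin n → Euc k → Euc k} {b b' : Fin n → ℝ} {T T' : ℝ → Euc k → Euc k}
  {x y : Euc k → Euc k}

namespace IsLinearizedSystem

lemma integrable {F : Type*} [NormedAddCommGroup F] (hL : IsLinearizedSystem μ S c H a)
    {q : Euc k → F} (hq : ContinuousOn q S) : Integrable q μ :=
  have := hL.isProb
  integrable_of_continuousOn_compact hL.isCompact hL.ae_mem hq

lemma integrable_inner (hL : IsLinearizedSystem μ S c H a) (hy : ContinuousOn y S) (l : Fin n) :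
    Integrable (fun θ => (inner ℝ (a l θ) (y θ) : ℝ)) μ :=
  hL.integrable ((hL.a_cont l).inner hy)

lemma response_sub (hL : IsLinearizedSystem μ S c H a) (hx : ContinuousOn x S)
    (hy : ContinuousOn y S) (l : Fin n) :
    response μ a (b - b') (fun θ => x θ - y θ) l = response μ a b x l - response μ a b' y l := by
  have h := integral_sub (hL.integrable_inner hx l) (hL.integrable_inner hy l)
  simp only [response, inner_sub_right, Pi.sub_apply, h]
  ring

lemma response_midpoint (hL : IsLinearizedSystem μ S c H a) (hx : ContinuousOn x S)
    (hy : ContinuousOn y S) (l : Fin n) :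
    response μ a b (fun θ => (1 / 2 : ℝ) • (x θ + y θ)) l
      = (response μ a b x l + response μ a b y l) / 2 := by
  have h := integral_add (hL.integrable_inner hx l) (hL.integrable_inner hy l)
  simp only [response, inner_smul_right, inner_add_right, integral_const_mul, h]
  ring

lemma quadEnergy_nonneg (hL : IsLinearizedSystem μ S c H a) :
    0 ≤ quadEnergy μ c H a b y := by
  refine add_nonneg (integral_nonneg_of_ae ?_)
    (mul_nonneg (by linarith [hL.c_pos]) (Finset.sum_nonneg fun l _ => sq_nonneg _))
  filter_upwards [hL.ae_mem] with θ hθ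
  exact mul_nonneg (by norm_num) (hL.H_nonneg θ hθ _)

lemma sum_response_sq_le (hL : IsLinearizedSystem μ S c H a) :
    c / 2 * ∑ l, response μ a b y l ^ 2 ≤ quadEnergy μ c H a b y := by
  refine le_add_of_nonneg_left (integral_nonneg_of_ae ?_)
  filter_upwards [hL.ae_mem] with θ hθ
  exact mul_nonneg (by norm_num) (hL.H_nonneg θ hθ _)

lemma continuousOn_quad (hL : IsLinearizedSystem μ S c H a) (hy : ContinuousOn y S) :
    ContinuousOn (fun θ => (1 / 2 : ℝ) * inner ℝ (H θ (y θ)) (y θ)) S :=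
  continuousOn_const.mul ((hL.H_cont.clm_apply hy).inner hy)

lemma continuousOn_quadVelocity (hL : IsLinearizedSystem μ S c H a) (hy : ContinuousOn y S) :
    ContinuousOn (quadVelocity μ c H a b y) S := by
  refine (hL.H_cont.clm_apply hy).neg.sub (continuousOn_const.fun_smul ?_)
  exact continuousOn_finsetSum _ fun l _ => continuousOn_const.fun_smul (hL.a_cont l)

/-- Integrating a continuous field `z` against the velocity. -/
lemma integral_inner_quadVelocity (hL : IsLinearizedSystem μ S c H a) (hy : ContinuousOn y S)
    {z : Euc k → Euc k} (hz : ContinuousOn z S) :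
    ∫ θ, inner ℝ (z θ) (quadVelocity μ c H a b y θ) ∂μ
      = -(∫ θ, inner ℝ (H θ (y θ)) (z θ) ∂μ)
        - c * ∑ l, response μ a b y l * ∫ θ, inner ℝ (a l θ) (z θ) ∂μ := by
  have e : ∀ θ, inner ℝ (z θ) (quadVelocity μ c H a b y θ)
      = -(inner ℝ (H θ (y θ)) (z θ))
        - c * ∑ l, response μ a b y l * inner ℝ (a l θ) (z θ) := by
    intro θ
    simp only [quadVelocity, inner_sub_right, inner_neg_right, inner_smul_right, inner_sum,
      real_inner_comm]
  have hi : ∀ l, Integrable (fun θ => response μ a b y l * inner ℝ (a l θ) (z θ)) μ := fun l =>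
    (hL.integrable_inner hz l).const_mul _
  simp only [e]
  rw [integral_sub, integral_neg, integral_const_mul, integral_finsetSum _ fun l _ => hi l]
  · simp only [integral_const_mul]
  · exact (hL.integrable ((hL.H_cont.clm_apply hy).inner hz)).neg
  · exact (integrable_finsetSum _ fun l _ => hi l).const_mul _

/-- Convexity of the energy: it lies above its tangent plane. -/
lemma integral_inner_sub_quadVelocity_le (hL : IsLinearizedSystem μ S c H a)
    (hx : ContinuousOn x S) (hy : ContinuousOn y S) :
    ∫ θ, inner ℝ (x θ - y θ) (quadVelocity μ c H a b x θ) ∂μ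
      ≤ quadEnergy μ c H a b y - quadEnergy μ c H a b x := by
  have hHx := (hL.H_cont.clm_apply hx)
  rw [hL.integral_inner_quadVelocity hx (hx.fun_sub hy)]
  have h1 : ∫ θ, (1 / 2 * inner ℝ (H θ (x θ)) (x θ) - inner ℝ (H θ (x θ)) (x θ - y θ)) ∂μ
      ≤ ∫ θ, 1 / 2 * inner ℝ (H θ (y θ)) (y θ) ∂μ := by
    refine integral_mono_ae ((hL.integrable (hL.continuousOn_quad hx)).sub
      (hL.integrable (hHx.inner (hx.fun_sub hy)))) (hL.integrable (hL.continuousOn_quad hy)) ?_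
    filter_upwards [hL.ae_mem] with θ hθ
    have h := hL.H_nonneg θ hθ (x θ - y θ)
    have hs : inner ℝ (H θ (y θ)) (x θ) = inner ℝ (H θ (x θ)) (y θ) := by
      rw [hL.H_symm θ hθ, real_inner_comm]
    simp only [map_sub, inner_sub_left, inner_sub_right] at h ⊢
    linarith
  rw [integral_sub (hL.integrable (hL.continuousOn_quad hx))
    (hL.integrable (hHx.inner (hx.fun_sub hy)))] at h1
  have h2 : ∀ l, ∫ θ, inner ℝ (a l θ) (x θ - y θ) ∂μ
      = response μ a b x l - response μ a b y l := fun l => by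
    have := hL.response_sub (b := b) (b' := b) hx hy l
    simpa [response] using this
  simp only [h2, quadEnergy]
  have h3 : ∑ l, response μ a b x l ^ 2 - 2 * ∑ l, response μ a b x l *
      (response μ a b x l - response μ a b y l) ≤ ∑ l, response μ a b y l ^ 2 := by
    rw [Finset.mul_sum, ← Finset.sum_sub_distrib]
    exact Finset.sum_le_sum fun l _ => by
      nlinarith [sq_nonneg (response μ a b x l - response μ a b y l)]
  have h4 := mul_le_mul_of_nonneg_left h3 (by linarith [hL.c_pos] : 0 ≤ c / 2)
  linarith

/-- Uniform convexity of the energy in the response. -/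
lemma quadEnergy_midpoint_le (hL : IsLinearizedSystem μ S c H a)
    (hx : ContinuousOn x S) (hy : ContinuousOn y S) :
    quadEnergy μ c H a b (fun θ => (1 / 2 : ℝ) • (x θ + y θ))
        + c / 8 * ∑ l, (response μ a b x l - response μ a b y l) ^ 2
      ≤ (quadEnergy μ c H a b x + quadEnergy μ c H a b y) / 2 := by
  have hm : ContinuousOn (fun θ => (1 / 2 : ℝ) • (x θ + y θ)) S :=
    continuousOn_const.fun_smul (hx.fun_add hy)
  have h1 : ∫ θ, 1 / 2 * inner ℝ (H θ ((1 / 2 : ℝ) • (x θ + y θ))) ((1 / 2 : ℝ) • (x θ + y θ)) ∂μ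
      ≤ ∫ θ, (1 / 2 * (1 / 2 * inner ℝ (H θ (x θ)) (x θ))
          + 1 / 2 * (1 / 2 * inner ℝ (H θ (y θ)) (y θ))) ∂μ := by
    refine integral_mono_ae (hL.integrable (hL.continuousOn_quad hm))
      (((hL.integrable (hL.continuousOn_quad hx)).const_mul _).add
      ((hL.integrable (hL.continuousOn_quad hy)).const_mul _)) ?_
    filter_upwards [hL.ae_mem] with θ hθ
    have h := hL.H_nonneg θ hθ (x θ - y θ)
    simp only [map_sub, map_add, map_smul, inner_sub_left, inner_sub_right, inner_add_left,
      inner_add_right, inner_smul_left, inner_smul_right, conj_trivial] at h ⊢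
    linarith
  rw [integral_add ((hL.integrable (hL.continuousOn_quad hx)).const_mul _)
      ((hL.integrable (hL.continuousOn_quad hy)).const_mul _),
    integral_const_mul (1 / 2) fun θ => 1 / 2 * inner ℝ (H θ (x θ)) (x θ),
    integral_const_mul (1 / 2) fun θ => 1 / 2 * inner ℝ (H θ (y θ)) (y θ)] at h1
  have h2 : ∑ l, response μ a b (fun θ => (1 / 2 : ℝ) • (x θ + y θ)) l ^ 2
      + 1 / 4 * ∑ l, (response μ a b x l - response μ a b y l) ^ 2
      = 1 / 2 * ∑ l, response μ a b x l ^ 2 + 1 / 2 * ∑ l, response μ a b y l ^ 2 := by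
    rw [Finset.mul_sum, Finset.mul_sum, Finset.mul_sum, ← Finset.sum_add_distrib,
      ← Finset.sum_add_distrib]
    refine Finset.sum_congr rfl fun l _ => ?_
    rw [hL.response_midpoint hx hy]
    ring
  simp only [quadEnergy]
  have h3 := congrArg (fun u => c / 2 * u) h2
  simp only [mul_add] at h3
  linarith

end IsLinearizedSystem

namespace IsLinearizedFlow

lemma continuousOn_slice (hT : IsLinearizedFlow μ S c H a b T) {t : ℝ} (ht : 0 ≤ t) :
    ContinuousOn (T t) S :=
  hT.cont.slice ht

/-- Differences of flows are flows, for the difference of the initial fluctuations. -/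
lemma sub (hL : IsLinearizedSystem μ S c H a) (hT : IsLinearizedFlow μ S c H a b T)
    (hT' : IsLinearizedFlow μ S c H a b' T') :
    IsLinearizedFlow μ S c H a (b - b') fun t θ => T t θ - T' t θ where
  cont := hT.cont.sub hT'.cont
  init θ hθ := by simp [hT.init θ hθ, hT'.init θ hθ]
  ode θ hθ t ht := by
    refine ((hT.ode θ hθ t ht).sub (hT'.ode θ hθ t ht)).congr_deriv ?_
    simp only [quadVelocity,
      hL.response_sub (hT.continuousOn_slice ht) (hT'.continuousOn_slice ht), map_sub, sub_smul,
      Finset.sum_sub_distrib, smul_sub]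
    abel

lemma continuousOn_response (hL : IsLinearizedSystem μ S c H a)
    (hT : IsLinearizedFlow μ S c H a b T) (l : Fin n) :
    ContinuousOn (fun t => response μ a b (T t) l) (Ici 0) := by
  have := hL.isProb
  refine continuousOn_const.add (continuousOn_integral_of_compact
    (q := fun t θ => inner ℝ (a l θ) (T t θ)) hL.isCompact hL.ae_mem ?_)
  exact ((hL.a_cont l).comp continuousOn_snd fun p hp => hp.2).inner hT.cont

lemma continuousOn_velocity (hL : IsLinearizedSystem μ S c H a)
    (hT : IsLinearizedFlow μ S c H a b T) :
    ContinuousOn (fun p : ℝ × Euc k => quadVelocity μ c H a b (T p.1) p.2) (Ici 0 ×ˢ S) := by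
  refine (((hL.H_cont.comp continuousOn_snd fun p hp => hp.2).clm_apply hT.cont).neg).sub
    (continuousOn_const.fun_smul (continuousOn_finsetSum _ fun l _ => ?_))
  exact ((hT.continuousOn_response hL l).comp continuousOn_fst fun p hp => hp.1).smul
    ((hL.a_cont l).comp continuousOn_snd fun p hp => hp.2)

lemma hasDerivAt_response (hL : IsLinearizedSystem μ S c H a)
    (hT : IsLinearizedFlow μ S c H a b T) (l : Fin n) {t : ℝ} (ht : 0 < t) :
    HasDerivAt (fun t => response μ a b (T t) l)
      (∫ θ, inner ℝ (a l θ) (quadVelocity μ c H a b (T t) θ) ∂μ) t := by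
  have := hL.isProb
  have ha : ContinuousOn (fun p : ℝ × Euc k => a l p.2) (Ici 0 ×ˢ S) :=
    (hL.a_cont l).comp continuousOn_snd fun p hp => hp.2
  refine (hasDerivAt_integral_of_compact (q := fun t θ => inner ℝ (a l θ) (T t θ))
    (q' := fun t θ => inner ℝ (a l θ) (quadVelocity μ c H a b (T t) θ))
    hL.isCompact hL.ae_mem (ha.inner hT.cont) (ha.inner (hT.continuousOn_velocity hL))
    (fun θ hθ t ht => ?_) ht).const_add (b l)
  simpa using (hasDerivWithinAt_const t (Ici 0) (a l θ)).inner ℝ (hT.ode θ hθ t ht)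

lemma continuousOn_quadEnergy (hL : IsLinearizedSystem μ S c H a)
    (hT : IsLinearizedFlow μ S c H a b T) :
    ContinuousOn (fun t => quadEnergy μ c H a b (T t)) (Ici 0) := by
  have := hL.isProb
  have hH := (hL.H_cont.comp continuousOn_snd fun (p : ℝ × Euc k) (hp : p ∈ Ici 0 ×ˢ S) => hp.2)
  refine (continuousOn_integral_of_compact
    (q := fun t θ => (1 / 2 : ℝ) * inner ℝ (H θ (T t θ)) (T t θ)) hL.isCompact hL.ae_mem
    (continuousOn_const.mul ((hH.clm_apply hT.cont).inner hT.cont))).add ?_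
  exact continuousOn_const.mul (continuousOn_finsetSum _ fun l _ =>
    (hT.continuousOn_response hL l).pow 2)

/-- Energy dissipation: the energy decreases at the rate of the squared `L²(μ)` speed. -/
lemma hasDerivAt_quadEnergy (hL : IsLinearizedSystem μ S c H a)
    (hT : IsLinearizedFlow μ S c H a b T) {t : ℝ} (ht : 0 < t) :
    HasDerivAt (fun t => quadEnergy μ c H a b (T t))
      (-∫ θ, ‖quadVelocity μ c H a b (T t) θ‖ ^ 2 ∂μ) t := by
  have := hL.isProb
  have hH := (hL.H_cont.comp continuousOn_snd fun (p : ℝ × Euc k) (hp : p ∈ Ici 0 ×ˢ S) => hp.2)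
  have h1 := hasDerivAt_integral_of_compact
    (q := fun t θ => (1 / 2 : ℝ) * inner ℝ (H θ (T t θ)) (T t θ))
    (q' := fun t θ => inner ℝ (H θ (T t θ)) (quadVelocity μ c H a b (T t) θ))
    hL.isCompact hL.ae_mem (continuousOn_const.mul ((hH.clm_apply hT.cont).inner hT.cont))
    ((hH.clm_apply hT.cont).inner (hT.continuousOn_velocity hL)) (fun θ hθ t ht => by
      have hd := hT.ode θ hθ t ht
      have hHd := (H θ).hasFDerivAt.comp_hasDerivWithinAt t hd
      refine ((hHd.inner ℝ hd).const_mul (1 / 2 : ℝ)).congr_deriv ?_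
      simp only [Function.comp_apply]
      rw [hL.H_symm θ hθ, real_inner_comm]
      ring) ht
  have h2 := (HasDerivAt.fun_sum fun l (_ : l ∈ Finset.univ) =>
    (hT.hasDerivAt_response hL l ht).pow 2).const_mul (c / 2)
  refine (h1.add h2).congr_deriv ?_
  have h3 := hL.integral_inner_quadVelocity (b := b) (hT.continuousOn_slice ht.le)
    (hL.continuousOn_quadVelocity (b := b) (hT.continuousOn_slice ht.le))
  simp only [real_inner_self_eq_norm_sq] at h3
  rw [h3]
  have h4 : c * ∑ l, response μ a b (T t) l *
        ∫ θ, inner ℝ (a l θ) (quadVelocity μ c H a b (T t) θ) ∂μ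
      = c / 2 * ∑ l, (2 : ℕ) * response μ a b (T t) l ^ (2 - 1) *
        ∫ θ, inner ℝ (a l θ) (quadVelocity μ c H a b (T t) θ) ∂μ := by
    rw [Finset.mul_sum, Finset.mul_sum]
    refine Finset.sum_congr rfl fun l _ => ?_
    simp
    ring
  rw [h4]
  ring

lemma antitoneOn_quadEnergy (hL : IsLinearizedSystem μ S c H a)
    (hT : IsLinearizedFlow μ S c H a b T) :
    AntitoneOn (fun t => quadEnergy μ c H a b (T t)) (Ici 0) := by
  refine antitoneOn_of_hasDerivWithinAt_nonpos (convex_Ici 0) (hT.continuousOn_quadEnergy hL)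
    (f' := fun t => -∫ θ, ‖quadVelocity μ c H a b (T t) θ‖ ^ 2 ∂μ) (fun t ht => ?_) fun t ht => ?_
  · rw [interior_Ici] at ht ⊢
    exact (hT.hasDerivAt_quadEnergy hL ht).hasDerivWithinAt
  · exact neg_nonpos.2 (integral_nonneg fun θ => by positivity)

lemma quadEnergy_zero (hL : IsLinearizedSystem μ S c H a)
    (hT : IsLinearizedFlow μ S c H a b T) :
    quadEnergy μ c H a b (T 0) = c / 2 * ∑ l, b l ^ 2 := by
  have h0 : ∀ᵐ θ ∂μ, T 0 θ = 0 := by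
    filter_upwards [hL.ae_mem] with θ hθ using hT.init θ hθ
  have h1 : ∫ θ, (1 / 2 : ℝ) * inner ℝ (H θ (T 0 θ)) (T 0 θ) ∂μ = 0 := by
    refine integral_eq_zero_of_ae ?_
    filter_upwards [h0] with θ hθ
    simp [hθ]
  have h2 : ∀ l, ∫ θ, inner ℝ (a l θ) (T 0 θ) ∂μ = 0 := fun l => by
    refine integral_eq_zero_of_ae ?_
    filter_upwards [h0] with θ hθ
    simp [hθ]
  simp only [quadEnergy, response, h1, h2, zero_add, add_zero]

/-- The response never exceeds its initial size. -/
lemma sum_response_sq_le (hL : IsLinearizedSystem μ S c H a)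
    (hT : IsLinearizedFlow μ S c H a b T) {t : ℝ} (ht : 0 ≤ t) :
    ∑ l, response μ a b (T t) l ^ 2 ≤ ∑ l, b l ^ 2 := by
  have h := (hL.sum_response_sq_le (b := b) (y := T t)).trans
    (hT.antitoneOn_quadEnergy hL (mem_Ici.2 le_rfl) (mem_Ici.2 ht) ht)
  simp only [hT.quadEnergy_zero hL] at h
  exact le_of_mul_le_mul_left h (by linarith [hL.c_pos])

/-- The usual rate for convex gradient flows, obtained from the Lyapunov function
`t (Φ(T_t) - Φ(y)) + ½ ∫ |T_t - y|² dμ`. -/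
lemma mul_quadEnergy_sub_le (hL : IsLinearizedSystem μ S c H a)
    (hT : IsLinearizedFlow μ S c H a b T) (hy : ContinuousOn y S) {t : ℝ} (ht : 0 ≤ t) :
    t * (quadEnergy μ c H a b (T t) - quadEnergy μ c H a b y) ≤ ∫ θ, 1 / 2 * ‖y θ‖ ^ 2 ∂μ := by
  have := hL.isProb
  have hy' : ContinuousOn (fun p : ℝ × Euc k => y p.2) (Ici 0 ×ˢ S) :=
    hy.comp continuousOn_snd fun p hp => hp.2
  have hc1 : ContinuousOn (fun p : ℝ × Euc k => (1 / 2 : ℝ) * ‖T p.1 p.2 - y p.2‖ ^ 2)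
    (Ici 0 ×ˢ S) := continuousOn_const.mul ((hT.cont.sub hy').norm.pow 2)
  set ψ : ℝ → ℝ := fun t => t * (quadEnergy μ c H a b (T t) - quadEnergy μ c H a b y)
    + ∫ θ, 1 / 2 * ‖T t θ - y θ‖ ^ 2 ∂μ with hψ
  have hanti : AntitoneOn ψ (Ici 0) := by
    refine antitoneOn_of_hasDerivWithinAt_nonpos (convex_Ici 0) ?_
      (f' := fun t => 1 * (quadEnergy μ c H a b (T t) - quadEnergy μ c H a b y)
        + t * (-∫ θ, ‖quadVelocity μ c H a b (T t) θ‖ ^ 2 ∂μ)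
        + ∫ θ, inner ℝ (T t θ - y θ) (quadVelocity μ c H a b (T t) θ) ∂μ)
      (fun t ht => ?_) fun t ht => ?_
    · exact (continuousOn_id.mul ((hT.continuousOn_quadEnergy hL).sub continuousOn_const)).add
        (continuousOn_integral_of_compact (q := fun t θ => 1 / 2 * ‖T t θ - y θ‖ ^ 2)
          hL.isCompact hL.ae_mem hc1)
    · rw [interior_Ici] at ht ⊢
      refine (((hasDerivAt_id t).mul ((hT.hasDerivAt_quadEnergy hL ht).sub_const _)).add
        (hasDerivAt_integral_of_compact (q := fun t θ => 1 / 2 * ‖T t θ - y θ‖ ^ 2)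
          (q' := fun t θ => inner ℝ (T t θ - y θ) (quadVelocity μ c H a b (T t) θ))
          hL.isCompact hL.ae_mem hc1
          ((hT.cont.sub hy').inner (hT.continuousOn_velocity hL)) (fun θ hθ s hs => ?_)
          ht)).hasDerivWithinAt
      refine (((hT.ode θ hθ s hs).sub_const (y θ)).norm_sq.const_mul (1 / 2 : ℝ)).congr_deriv ?_
      ring
    · rw [interior_Ici] at ht
      have h1 := hL.integral_inner_sub_quadVelocity_le (b := b) (hT.continuousOn_slice ht.le) hy
      have h2 : 0 ≤ t * ∫ θ, ‖quadVelocity μ c H a b (T t) θ‖ ^ 2 ∂μ :=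
        mul_nonneg ht.le (integral_nonneg fun θ => by positivity)
      linarith
  have h0 : ψ 0 = ∫ θ, 1 / 2 * ‖y θ‖ ^ 2 ∂μ := by
    simp only [hψ, zero_mul, zero_add]
    refine integral_congr_ae ?_
    filter_upwards [hL.ae_mem] with θ hθ
    simp [hT.init θ hθ]
  have h1 : ψ t ≤ ψ 0 := hanti (mem_Ici.2 le_rfl) (mem_Ici.2 ht) ht
  rw [h0] at h1
  refine le_trans (le_add_of_nonneg_right ?_) h1
  exact integral_nonneg fun θ => by positivity

/-- The response converges as time tends to infinity: the energy decreases to its infimum, and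
along a minimizing family the response is Cauchy by uniform convexity. -/
lemma exists_tendsto_response (hL : IsLinearizedSystem μ S c H a)
    (hT : IsLinearizedFlow μ S c H a b T) (l : Fin n) :
    ∃ γ, Tendsto (fun t => response μ a b (T t) l) atTop (𝓝 γ) := by
  set Φ : ℝ → ℝ := fun t => quadEnergy μ c H a b (T t) with hΦ
  have hanti := hT.antitoneOn_quadEnergy hL
  obtain ⟨m, hm⟩ : ∃ m, Tendsto Φ atTop (𝓝 m) := by
    have h1 : Antitone fun t => Φ (max t 0) := fun s t hst =>
      hanti (le_max_right s 0) (le_max_right t 0) (max_le_max_right 0 hst)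
    have h2 : BddBelow (range fun t => Φ (max t 0)) :=
      ⟨0, by rintro _ ⟨t, rfl⟩; exact hL.quadEnergy_nonneg⟩
    refine ⟨_, (tendsto_atTop_ciInf h1 h2).congr' ?_⟩
    filter_upwards [eventually_ge_atTop 0] with t ht
    rw [max_eq_left ht]
  have hmin : ∀ y, ContinuousOn y S → m ≤ quadEnergy μ c H a b y := by
    intro y hy
    have h1 : Tendsto (fun t : ℝ => quadEnergy μ c H a b y + (∫ θ, 1 / 2 * ‖y θ‖ ^ 2 ∂μ) / t)
        atTop (𝓝 (quadEnergy μ c H a b y + 0)) :=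
      tendsto_const_nhds.add (tendsto_const_nhds.div_atTop tendsto_id)
    rw [add_zero] at h1
    refine le_of_tendsto_of_tendsto hm h1 ?_
    filter_upwards [eventually_gt_atTop 0] with t ht
    have h2 := hT.mul_quadEnergy_sub_le hL hy ht.le
    rw [← sub_le_iff_le_add', le_div_iff₀ ht, mul_comm]
    exact h2
  have hc := hL.c_pos
  have hcauchy : Cauchy (map (fun t => response μ a b (T t) l) atTop) := by
    -- two late times and their midpoint all have energy close to the infimum `m`
    refine Metric.cauchy_iff.2 ⟨inferInstance, fun ε hε => ?_⟩
    have h1 : ∀ᶠ t in atTop, 0 ≤ t ∧ Φ t < m + c / 8 * ε ^ 2 / 4 :=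
      (eventually_ge_atTop 0).and (hm.eventually_lt_const (by
        have : 0 < c / 8 * ε ^ 2 / 4 := by positivity
        linarith))
    refine ⟨_, image_mem_map h1, ?_⟩
    rintro _ ⟨s, ⟨hs0, hs⟩, rfl⟩ _ ⟨t, ⟨ht0, ht⟩, rfl⟩
    have h2 := hL.quadEnergy_midpoint_le (b := b) (hT.continuousOn_slice hs0)
      (hT.continuousOn_slice ht0)
    have h3 := hmin (fun θ => (1 / 2 : ℝ) • (T s θ + T t θ))
      (continuousOn_const.fun_smul ((hT.continuousOn_slice hs0).fun_add (hT.continuousOn_slice ht0)))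
    have h4 : (response μ a b (T s) l - response μ a b (T t) l) ^ 2
        ≤ ∑ l, (response μ a b (T s) l - response μ a b (T t) l) ^ 2 :=
      Finset.single_le_sum (f := fun l => (response μ a b (T s) l - response μ a b (T t) l) ^ 2)
        (fun _ _ => sq_nonneg _) (Finset.mem_univ l)
    have h5 := mul_le_mul_of_nonneg_left h4 (by positivity : 0 ≤ c / 8)
    simp only [hΦ] at hs ht
    have h6 : c / 8 * (response μ a b (T s) l - response μ a b (T t) l) ^ 2 < c / 8 * ε ^ 2 := by
      have : 0 < c / 8 * ε ^ 2 := by positivity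
      linarith
    rw [Real.dist_eq]
    exact abs_lt_of_sq_lt_sq (lt_of_mul_lt_mul_left h6 (by positivity)) hε.le
  exact CompleteSpace.complete hcauchy

end IsLinearizedFlow

end Linearized

/-! ### Energy and loss as quadratic functionals of finitely many integrals -/

namespace Problem

variable {k d n : ℕ} {Q : Problem k d n}

lemma integral_nu (Q : Problem k d n) (h : Euc d → ℝ) :
    ∫ x, h x ∂Q.nu = (n : ℝ)⁻¹ * ∑ l, h (Q.x l) := by
  rw [nu, integral_smul_measure, integral_finsetSum_measure]
  · simp
  · exact fun l _ => integrable_dirac (by simp)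

lemma normSq_eq (Q : Problem k d n) (h : Euc d → ℝ) :
    Q.normSq h = (n : ℝ)⁻¹ * ∑ l, h (Q.x l) ^ 2 :=
  Q.integral_nu _

lemma K_eq (Q : Problem k d n) (θ θ' : Euc k) :
    Q.K θ θ' = ∑ l, ((n : ℝ)⁻¹ * Q.phi θ' (Q.x l)) * Q.phi θ (Q.x l) := by
  rw [K, integral_nu, Finset.mul_sum]
  exact Finset.sum_congr rfl fun l _ => by ring

/-- The potential `V(·, m) = -F + ∫ K(·, θ') m(dθ')`, with the integral over `m` taken inside the
sum over the data points. -/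
def potential (Q : Problem k d n) (m : Measure (Euc k)) (θ : Euc k) : ℝ :=
  -1 * Q.F θ + ∑ l, ((n : ℝ)⁻¹ * Q.f m (Q.x l)) * Q.phi θ (Q.x l)

namespace Regular

lemma contDiffOn_phi (hQ : Q.Regular) (l : Fin n) :
    ContDiffOn ℝ 2 (fun θ => Q.phi θ (Q.x l)) Q.D := by
  obtain ⟨L, hL⟩ := hQ.hess_phi_lipschitz
  exact contDiffOn_two_of_gradient hQ.isOpen_D (hQ.phi_diff _ (hQ.data_mem l))
    (hQ.grad_phi_diff _ (hQ.data_mem l)) (hL _ (hQ.data_mem l)).continuousOn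

lemma contDiffOn_F (hQ : Q.Regular) : ContDiffOn ℝ 2 Q.F Q.D := by
  have : Q.F = fun θ => (n : ℝ)⁻¹ * ∑ l, Q.fstar (Q.x l) * Q.phi θ (Q.x l) - Q.lam * Q.r θ := by
    ext θ
    rw [F, integral_nu]
  rw [this]
  exact (contDiffOn_const.mul (ContDiffOn.sum fun l _ =>
    contDiffOn_const.mul (hQ.contDiffOn_phi l))).sub (contDiffOn_const.mul hQ.r_smooth)

lemma contDiffOn_feature_sum (hQ : Q.Regular) (u : Fin n → ℝ) :
    ContDiffOn ℝ 2 (fun θ => ∑ l, u l * Q.phi θ (Q.x l)) Q.D :=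
  ContDiffOn.sum fun l _ => contDiffOn_const.mul (hQ.contDiffOn_phi l)

lemma contDiffOn_potential (hQ : Q.Regular) (m : Measure (Euc k)) :
    ContDiffOn ℝ 2 (Q.potential m) Q.D :=
  (contDiffOn_const.mul hQ.contDiffOn_F).add (hQ.contDiffOn_feature_sum _)

lemma gradK_eq (hQ : Q.Regular) {θ : Euc k} (hθ : θ ∈ Q.D) (θ' : Euc k) :
    Q.gradK θ θ' = ∑ l, ((n : ℝ)⁻¹ * Q.phi θ' (Q.x l)) •
      gradient (fun η => Q.phi η (Q.x l)) θ := by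
  simp only [gradK, K_eq]
  exact gradient_sum_mul _ hQ.contDiffOn_phi hQ.isOpen_D hθ

lemma hessK_eq (hQ : Q.Regular) {θ : Euc k} (hθ : θ ∈ Q.D) (θ' : Euc k) :
    Q.hessK θ θ' = ∑ l, ((n : ℝ)⁻¹ * Q.phi θ' (Q.x l)) •
      hess (fun η => Q.phi η (Q.x l)) θ := by
  simp only [hessK, K_eq]
  exact hess_sum_mul _ hQ.contDiffOn_phi hQ.isOpen_D hθ

lemma mixedK_apply (hQ : Q.Regular) {θ θ' : Euc k} (hθ : θ ∈ Q.D) (hθ' : θ' ∈ Q.D) (v : Euc k) :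
    Q.mixedK θ θ' v = (n : ℝ)⁻¹ • ∑ l, (inner ℝ (gradient (fun η => Q.phi η (Q.x l)) θ') v : ℝ) •
      gradient (fun η => Q.phi η (Q.x l)) θ := by
  have h : HasFDerivAt (fun η => Q.gradK θ η)
      (∑ l, ((n : ℝ)⁻¹ • fderiv ℝ (fun η => Q.phi η (Q.x l)) θ').smulRight
        (gradient (fun η => Q.phi η (Q.x l)) θ)) θ' := by
    simp only [hQ.gradK_eq hθ]
    refine HasFDerivAt.fun_sum fun l _ => ?_
    exact ((((hQ.contDiffOn_phi l).contDiffAt (hQ.isOpen_D.mem_nhds hθ')).differentiableAt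
      (by norm_num)).hasFDerivAt.const_mul _).smul_const _
  rw [mixedK, h.fderiv, Finset.smul_sum]
  simp [smul_smul, inner_gradient_left]

variable {μ : Measure (Euc k)}

lemma gradV_eq (hQ : Q.Regular) {Θ : Euc k → Euc k} {θ : Euc k} (hθ : θ ∈ Q.D)
    (hi : ∀ l, Integrable (fun θ' => Q.phi (Θ θ') (Q.x l)) μ) :
    Q.gradV μ Θ θ = -gradient Q.F θ + ∑ l, ((n : ℝ)⁻¹ * ∫ θ', Q.phi (Θ θ') (Q.x l) ∂μ) •
      gradient (fun η => Q.phi η (Q.x l)) θ := by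
  simp only [gradV, hQ.gradK_eq hθ]
  rw [integral_finsetSum _ fun l _ => ((hi l).const_mul _).smul_const _]
  simp only [integral_smul_const, integral_const_mul]

lemma hessV_eq (hQ : Q.Regular) {Θ : Euc k → Euc k} {θ : Euc k} (hθ : θ ∈ Q.D)
    (hi : ∀ l, Integrable (fun θ' => Q.phi (Θ θ') (Q.x l)) μ) :
    Q.hessV μ Θ θ = -hess Q.F θ + ∑ l, ((n : ℝ)⁻¹ * ∫ θ', Q.phi (Θ θ') (Q.x l) ∂μ) •
      hess (fun η => Q.phi η (Q.x l)) θ := by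
  simp only [hessV, hQ.hessK_eq hθ]
  rw [integral_finsetSum _ fun l _ => ((hi l).const_mul _).smul_const _]
  simp only [integral_smul_const, integral_const_mul]

lemma gradient_potential (hQ : Q.Regular) {θ : Euc k} (hθ : θ ∈ Q.D) :
    gradient (Q.potential μ) θ = -gradient Q.F θ + ∑ l, ((n : ℝ)⁻¹ * Q.f μ (Q.x l)) •
      gradient (fun η => Q.phi η (Q.x l)) θ := by
  have h := ((contDiffOn_const (c := (-1 : ℝ))).mul hQ.contDiffOn_F).gradient_add
    (hQ.contDiffOn_feature_sum fun l => (n : ℝ)⁻¹ * Q.f μ (Q.x l)) hQ.isOpen_D hθ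
  rw [hQ.contDiffOn_F.gradient_const_mul _ hQ.isOpen_D hθ,
    gradient_sum_mul _ hQ.contDiffOn_phi hQ.isOpen_D hθ, neg_smul, one_smul] at h
  exact h

lemma hess_potential (hQ : Q.Regular) {θ : Euc k} (hθ : θ ∈ Q.D) :
    hess (Q.potential μ) θ = -hess Q.F θ + ∑ l, ((n : ℝ)⁻¹ * Q.f μ (Q.x l)) •
      hess (fun η => Q.phi η (Q.x l)) θ := by
  have h := ((contDiffOn_const (c := (-1 : ℝ))).mul hQ.contDiffOn_F).hess_add
    (hQ.contDiffOn_feature_sum fun l => (n : ℝ)⁻¹ * Q.f μ (Q.x l)) hQ.isOpen_D hθ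
  rw [hQ.contDiffOn_F.hess_const_mul _ hQ.isOpen_D hθ,
    hess_sum_mul _ hQ.contDiffOn_phi hQ.isOpen_D hθ] at h
  have e : (-1 : ℝ) • hess Q.F θ = -hess Q.F θ := by
    ext1 v
    simp
  rw [e] at h
  exact h

/-- The double integral in the energy is a sum of squares over the data points. -/
lemma energy_eq {G : Euc k → Euc k}
    (hi : ∀ l, Integrable (fun θ => Q.phi (G θ) (Q.x l)) μ) :
    Q.energy μ G = -(∫ θ, Q.F (G θ) ∂μ)
      + 1 / 2 * ((n : ℝ)⁻¹ * ∑ l, (∫ θ, Q.phi (G θ) (Q.x l) ∂μ) ^ 2) := by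
  have h1 : ∀ θ, ∫ θ', Q.K (G θ) (G θ') ∂μ
      = ∑ l, ((n : ℝ)⁻¹ * ∫ θ', Q.phi (G θ') (Q.x l) ∂μ) * Q.phi (G θ) (Q.x l) := fun θ => by
    simp only [K_eq]
    rw [integral_finsetSum _ fun l _ => ((hi l).const_mul _).mul_const _]
    simp only [integral_mul_const, integral_const_mul]
  simp only [energy, h1]
  rw [integral_finsetSum _ fun l _ => (hi l).const_mul _]
  simp only [integral_const_mul]
  congr 2
  rw [Finset.mul_sum]
  exact Finset.sum_congr rfl fun l _ => by ring

variable [IsProbabilityMeasure μ] {C : Set (Euc k)}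

lemma _root_.integrable_comp_of_continuousOn {D C : Set (Euc k)} {q : Euc k → ℝ}
    (hq : ContinuousOn q D) (hC : IsCompact C) (hCD : C ⊆ D) {G : Euc k → Euc k}
    (hG : AEMeasurable G μ) (hmem : ∀ᵐ θ ∂μ, G θ ∈ C) : Integrable (fun θ => q (G θ)) μ := by
  have : IsProbabilityMeasure (μ.map G) := Measure.isProbabilityMeasure_map hG
  exact (integrable_of_continuousOn_compact hC
    ((ae_map_iff hG hC.measurableSet).2 hmem) (hq.mono hCD)).comp_aemeasurable hG

lemma integrable_phi_comp (hQ : Q.Regular) (hC : IsCompact C) (hCD : C ⊆ Q.D) {G : Euc k → Euc k}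
    (hG : AEMeasurable G μ) (hmem : ∀ᵐ θ ∂μ, G θ ∈ C) (l : Fin n) :
    Integrable (fun θ => Q.phi (G θ) (Q.x l)) μ :=
  integrable_comp_of_continuousOn (hQ.contDiffOn_phi l).continuousOn hC hCD hG hmem

lemma integrable_F_comp (hQ : Q.Regular) (hC : IsCompact C) (hCD : C ⊆ Q.D) {G : Euc k → Euc k}
    (hG : AEMeasurable G μ) (hmem : ∀ᵐ θ ∂μ, G θ ∈ C) :
    Integrable (fun θ => Q.F (G θ)) μ :=
  integrable_comp_of_continuousOn hQ.contDiffOn_F.continuousOn hC hCD hG hmem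

/-- The loss of a measure carried by a compact subset of `D`, in the same form as the energy. -/
lemma loss_eq (hQ : Q.Regular) (hC : IsCompact C) (hCD : C ⊆ Q.D) (hmem : ∀ᵐ θ ∂μ, θ ∈ C) :
    Q.loss μ = -(∫ θ, Q.F θ ∂μ)
      + 1 / 2 * ((n : ℝ)⁻¹ * ∑ l, (∫ θ, Q.phi θ (Q.x l) ∂μ) ^ 2)
      + 1 / 2 * Q.normSq Q.fstar := by
  have hi : ∀ l, Integrable (fun θ => Q.phi θ (Q.x l)) μ :=
    hQ.integrable_phi_comp hC hCD aemeasurable_id hmem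
  have hr : Integrable Q.r μ :=
    integrable_of_continuousOn_compact hC hmem (hQ.r_smooth.continuousOn.mono hCD)
  have hF : ∫ θ, Q.F θ ∂μ = (n : ℝ)⁻¹ * ∑ l, Q.fstar (Q.x l) * ∫ θ, Q.phi θ (Q.x l) ∂μ
      - Q.lam * ∫ θ, Q.r θ ∂μ := by
    simp only [F, integral_nu]
    rw [integral_sub ((integrable_finsetSum _ fun l _ => (hi l).const_mul _).const_mul _)
      (hr.const_mul _), integral_const_mul, integral_const_mul,
      integral_finsetSum _ fun l _ => (hi l).const_mul _]
    simp only [integral_const_mul]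
  rw [loss, hF, normSq_eq, normSq_eq]
  have h : ∑ l, (Q.f μ (Q.x l) - Q.fstar (Q.x l)) ^ 2
      = ∑ l, (∫ θ, Q.phi θ (Q.x l) ∂μ) ^ 2
        - 2 * ∑ l, Q.fstar (Q.x l) * (∫ θ, Q.phi θ (Q.x l) ∂μ)
        + ∑ l, Q.fstar (Q.x l) ^ 2 := by
    rw [Finset.mul_sum, ← Finset.sum_sub_distrib, ← Finset.sum_add_distrib]
    exact Finset.sum_congr rfl fun l _ => by simp only [f]; ring
  rw [h]
  ring

lemma integrable_potential_comp (hQ : Q.Regular) (hC : IsCompact C) (hCD : C ⊆ Q.D)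
    {m : Measure (Euc k)} {G : Euc k → Euc k}
    (hG : AEMeasurable G μ) (hmem : ∀ᵐ θ ∂μ, G θ ∈ C) :
    Integrable (fun θ => Q.potential m (G θ)) μ :=
  integrable_comp_of_continuousOn (hQ.contDiffOn_potential m).continuousOn hC hCD hG hmem

lemma integral_potential_comp (hQ : Q.Regular) (hC : IsCompact C) (hCD : C ⊆ Q.D)
    {m : Measure (Euc k)} {G : Euc k → Euc k}
    (hG : AEMeasurable G μ) (hmem : ∀ᵐ θ ∂μ, G θ ∈ C) :
    ∫ θ, Q.potential m (G θ) ∂μ = -(∫ θ, Q.F (G θ) ∂μ)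
      + (n : ℝ)⁻¹ * ∑ l, Q.f m (Q.x l) * ∫ θ, Q.phi (G θ) (Q.x l) ∂μ := by
  have hi := hQ.integrable_phi_comp hC hCD hG hmem
  simp only [potential]
  rw [integral_add ((hQ.integrable_F_comp hC hCD hG hmem).const_mul _)
    (integrable_finsetSum _ fun l _ => (hi l).const_mul _),
    integral_finsetSum _ fun l _ => (hi l).const_mul _]
  simp only [integral_const_mul, Finset.mul_sum, mul_assoc, neg_one_mul, integral_neg]

/-- The energy is the potential plus a positive quadratic remainder, exactly. -/
lemma energy_sub_energy_id (hQ : Q.Regular) (hC : IsCompact C) (hCD : C ⊆ Q.D)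
    (hμ : ∀ᵐ θ ∂μ, θ ∈ C) {G : Euc k → Euc k} (hG : AEMeasurable G μ)
    (hmem : ∀ᵐ θ ∂μ, G θ ∈ C) :
    Q.energy μ G - Q.energy μ id = ∫ θ, (Q.potential μ (G θ) - Q.potential μ θ) ∂μ
      + 1 / 2 * ((n : ℝ)⁻¹ *
        ∑ l, (∫ θ, (Q.phi (G θ) (Q.x l) - Q.phi θ (Q.x l)) ∂μ) ^ 2) := by
  have hi := hQ.integrable_phi_comp hC hCD hG hmem
  have hi0 : ∀ l, Integrable (fun θ => Q.phi (id θ) (Q.x l)) μ :=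
    hQ.integrable_phi_comp hC hCD aemeasurable_id hμ
  have hP0 := hQ.integral_potential_comp (m := μ) hC hCD (aemeasurable_id (μ := μ)) hμ
  have hi1 := hQ.integrable_potential_comp (m := μ) hC hCD (aemeasurable_id (μ := μ)) hμ
  rw [energy_eq hi, energy_eq hi0]
  simp only [id] at hi0 hi1 hP0 ⊢
  rw [integral_sub (hQ.integrable_potential_comp hC hCD hG hmem) hi1,
    hQ.integral_potential_comp hC hCD hG hmem, hP0]
  have h : ∑ l, (∫ θ, (Q.phi (G θ) (Q.x l) - Q.phi θ (Q.x l)) ∂μ) ^ 2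
      = ∑ l, (∫ θ, Q.phi (G θ) (Q.x l) ∂μ) ^ 2
        - 2 * ∑ l, Q.f μ (Q.x l) * (∫ θ, Q.phi (G θ) (Q.x l) ∂μ)
        + 2 * ∑ l, Q.f μ (Q.x l) * (∫ θ, Q.phi θ (Q.x l) ∂μ)
        - ∑ l, (∫ θ, Q.phi θ (Q.x l) ∂μ) ^ 2 := by
    rw [Finset.mul_sum, Finset.mul_sum, ← Finset.sum_sub_distrib, ← Finset.sum_add_distrib,
      ← Finset.sum_sub_distrib]
    refine Finset.sum_congr rfl fun l _ => ?_
    rw [integral_sub (hi l) (hi0 l)]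
    simp only [f]
    ring
  rw [h]
  ring

/-- The same expansion for the loss. -/
lemma loss_sub_loss (hQ : Q.Regular) (hC : IsCompact C) (hCD : C ⊆ Q.D)
    (hμ : ∀ᵐ θ ∂μ, θ ∈ C) {ρ : Measure (Euc k)} [IsProbabilityMeasure ρ]
    (hρ : ∀ᵐ θ ∂ρ, θ ∈ C) :
    Q.loss ρ - Q.loss μ = (∫ θ, Q.potential μ θ ∂ρ - ∫ θ, Q.potential μ θ ∂μ)
      + 1 / 2 * ((n : ℝ)⁻¹ *
        ∑ l, (∫ θ, Q.phi θ (Q.x l) ∂ρ - ∫ θ, Q.phi θ (Q.x l) ∂μ) ^ 2) := by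
  have hP0 := hQ.integral_potential_comp (m := μ) hC hCD (aemeasurable_id (μ := μ)) hμ
  have hP1 := hQ.integral_potential_comp (m := μ) hC hCD (aemeasurable_id (μ := ρ)) hρ
  simp only [id] at hP0 hP1
  rw [hQ.loss_eq hC hCD hμ, hQ.loss_eq hC hCD hρ, hP0, hP1]
  have h : ∑ l, (∫ θ, Q.phi θ (Q.x l) ∂ρ - ∫ θ, Q.phi θ (Q.x l) ∂μ) ^ 2
      = ∑ l, (∫ θ, Q.phi θ (Q.x l) ∂ρ) ^ 2
        - 2 * ∑ l, Q.f μ (Q.x l) * (∫ θ, Q.phi θ (Q.x l) ∂ρ)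
        + 2 * ∑ l, Q.f μ (Q.x l) * (∫ θ, Q.phi θ (Q.x l) ∂μ)
        - ∑ l, (∫ θ, Q.phi θ (Q.x l) ∂μ) ^ 2 := by
    rw [Finset.mul_sum, Finset.mul_sum, ← Finset.sum_sub_distrib, ← Finset.sum_add_distrib,
      ← Finset.sum_sub_distrib]
    refine Finset.sum_congr rfl fun l _ => ?_
    simp only [f]
    ring
  rw [h]
  ring

end Regular

end Problem

/-! ### First- and second-order optimality conditions -/

namespace Problem

variable {k d n : ℕ} {Q : Problem k d n} {μ : Measure (Euc k)}

lemma ae_mem_support : ∀ᵐ θ ∂μ, θ ∈ μ.support := Measure.support_mem_ae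

/-- A field that is continuous near the support and vanishes almost everywhere vanishes at every
point of the support. -/
lemma eq_zero_on_support {D : Set (Euc k)} (hD : IsOpen D) {u : Euc k → Euc k}
    (hu : ContinuousOn u D) (h0 : ∀ᵐ θ ∂μ, u θ = 0) {θ : Euc k} (hθ : θ ∈ μ.support)
    (hθD : θ ∈ D) : u θ = 0 := by
  by_contra hne
  have h1 : ∀ᶠ η in 𝓝 θ, u η ≠ 0 := (hu.continuousAt (hD.mem_nhds hθD)).eventually_ne hne
  have h2 : 0 < μ {η | u η ≠ 0} := (Measure.mem_support_iff_forall _).1 hθ _ h1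
  exact h2.ne' (ae_iff.1 h0)

lemma Regular.exists_cthickening_subset (hQ : Q.Regular) (hcomp : IsCompact μ.support)
    (hsupp : μ.support ⊆ Q.D) : ∃ δ > 0, Metric.cthickening δ μ.support ⊆ Q.D :=
  hcomp.exists_cthickening_subset_open hQ.isOpen_D hsupp

variable [IsProbabilityMeasure μ]

namespace Regular

/-- The energy of `G ∘ Ψ` is that of `G` when `Ψ` preserves `μ`. -/
lemma energy_comp_of_map_eq (hQ : Q.Regular) {C : Set (Euc k)} (hC : IsCompact C) (hCD : C ⊆ Q.D)
    {Ψ G : Euc k → Euc k} (hΨ : AEMeasurable Ψ μ) (hmap : μ.map Ψ = μ) (hG : Measurable G)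
    (hmem : ∀ᵐ θ ∂μ, G θ ∈ C) : Q.energy μ (fun θ => G (Ψ θ)) = Q.energy μ G := by
  have hi := hQ.integrable_phi_comp hC hCD hG.aemeasurable hmem
  have hF := hQ.integrable_F_comp hC hCD hG.aemeasurable hmem
  have hcomp : ∀ q : Euc k → ℝ, Integrable q μ →
      Integrable (fun θ => q (Ψ θ)) μ ∧ ∫ θ, q (Ψ θ) ∂μ = ∫ θ, q θ ∂μ := by
    intro q hq
    have hq' : Integrable q (μ.map Ψ) := by rwa [hmap]
    refine ⟨hq'.comp_aemeasurable hΨ, ?_⟩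
    rw [← integral_map hΨ hq'.aestronglyMeasurable, hmap]
  rw [energy_eq hi, energy_eq fun l => (hcomp _ (hi l)).1]
  simp only [fun l => (hcomp _ (hi l)).2, (hcomp _ hF).2]

/-- If a map that preserves `μ` is a local minimizer of the energy, then so is the identity. -/
lemma exists_energy_id_le (hQ : Q.Regular) (hcomp : IsCompact μ.support)
    (hsupp : μ.support ⊆ Q.D) {Ψ : Euc k → Euc k} (hmap : μ.map Ψ = μ)
    (hmin : Q.IsLocalMinMap μ Ψ) :
    ∃ ε > 0, ∀ C, IsCompact C → C ⊆ Q.D → ∀ G : Euc k → Euc k, Measurable G →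
      (∀ θ ∈ μ.support, G θ ∈ C) → (∀ θ ∈ μ.support, dist (G θ) θ ≤ ε) →
      Q.energy μ id ≤ Q.energy μ G := by
  obtain ⟨ε, hε, hmin⟩ := hmin
  refine ⟨ε, hε, fun C hC hCD G hG hmem hdist => ?_⟩
  -- a map that is not almost everywhere measurable pushes `μ` to the zero measure
  have hΨ : AEMeasurable Ψ μ := by
    by_contra h
    rw [Measure.map_of_not_aemeasurable h] at hmap
    exact IsProbabilityMeasure.ne_zero μ hmap.symm
  have hmap' : μ.map (hΨ.mk Ψ) = μ := by rw [← Measure.map_congr hΨ.ae_eq_mk, hmap]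
  have hS : ∀ᵐ θ ∂μ, hΨ.mk Ψ θ ∈ μ.support := by
    refine ae_of_ae_map hΨ.measurable_mk.aemeasurable ?_
    rw [hmap']
    exact ae_mem_support
  have hle := hmin (fun θ => G (hΨ.mk Ψ θ)) (hG.comp hΨ.measurable_mk)
    (by filter_upwards [hS] with θ hθ using hCD (hmem _ hθ))
    (by filter_upwards [hS, hΨ.ae_eq_mk] with θ hθ heq
        rw [heq]
        exact hdist _ hθ)
  rw [hQ.energy_comp_of_map_eq hC hCD hΨ.measurable_mk.aemeasurable hmap' hG
    (by filter_upwards [ae_mem_support (μ := μ)] with θ hθ using hmem θ hθ)] at hle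
  refine le_trans (le_of_eq ?_) hle
  exact (hQ.energy_comp_of_map_eq (G := id) hcomp hsupp hΨ hmap measurable_id
    ae_mem_support).symm

/-- Taylor bounds for the features, with one constant for all of them. -/
lemma exists_phi_taylor_bounds (hQ : Q.Regular) {S : Set (Euc k)} (hS : IsCompact S) {δ : ℝ}
    (hδ : Metric.cthickening δ S ⊆ Q.D) :
    ∃ C, 0 ≤ C ∧ ∀ l, ∀ θ ∈ S, ∀ v : Euc k, ‖v‖ ≤ δ →
      |Q.phi (θ + v) (Q.x l) - Q.phi θ (Q.x l)| ≤ C * ‖v‖ ∧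
      |Q.phi (θ + v) (Q.x l) - Q.phi θ (Q.x l) -
        inner ℝ (gradient (fun η => Q.phi η (Q.x l)) θ) v| ≤ C * ‖v‖ ^ 2 := by
  choose C hC0 hC using fun l => exists_taylor_bounds (hQ.contDiffOn_phi l) hQ.isOpen_D hS hδ
  refine ⟨∑ l, C l, Finset.sum_nonneg fun l _ => hC0 l, fun l θ hθ v hv => ?_⟩
  have hle : C l ≤ ∑ l, C l := Finset.single_le_sum (fun l _ => hC0 l) (Finset.mem_univ l)
  obtain ⟨h1, h2⟩ := hC l θ hθ v hv
  exact ⟨h1.trans (by gcongr), h2.trans (by gcongr)⟩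

lemma inv_mul_sum_sq_le (hn : 0 < n) {u : Fin n → ℝ} {b : ℝ} (hu : ∀ l, |u l| ≤ b) :
    (n : ℝ)⁻¹ * ∑ l, u l ^ 2 ≤ b ^ 2 := by
  have h : ∑ l, u l ^ 2 ≤ ∑ _l : Fin n, b ^ 2 := Finset.sum_le_sum fun l _ =>
    sq_le_sq' (abs_le.1 (hu l)).1 (abs_le.1 (hu l)).2
  rw [Finset.sum_const, Finset.card_univ, Fintype.card_fin, nsmul_eq_mul] at h
  rw [inv_mul_le_iff₀ (by positivity)]
  exact h

lemma abs_integral_le_of_support {q : Euc k → ℝ} {b : ℝ} (hq : ∀ θ ∈ μ.support, |q θ| ≤ b) :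
    |∫ θ, q θ ∂μ| ≤ b := by
  have h := norm_integral_le_of_norm_le_const (f := q) (C := b) (μ := μ)
    (by filter_upwards [ae_mem_support (μ := μ)] with θ hθ using hq θ hθ)
  simpa using h

/-- Stationarity: the potential of a locally minimal `μ` has zero gradient on the support. The
test perturbation is `-s ∇V`. -/
lemma gradient_potential_eq_zero (hn : 0 < n) (hQ : Q.Regular) (hcomp : IsCompact μ.support)
    (hsupp : μ.support ⊆ Q.D) {Ψ : Euc k → Euc k} (hmap : μ.map Ψ = μ)
    (hmin : Q.IsLocalMinMap μ Ψ) {θ : Euc k} (hθ : θ ∈ μ.support) :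
    gradient (Q.potential μ) θ = 0 := by
  have hV := hQ.contDiffOn_potential μ
  have hgc : ContinuousOn (gradient (Q.potential μ)) Q.D :=
    (hV.gradient_one hQ.isOpen_D).continuousOn
  have hgS := hgc.mono hsupp
  refine eq_zero_on_support hQ.isOpen_D hgc ?_ hθ (hsupp hθ)
  obtain ⟨ε, hε, hle⟩ := hQ.exists_energy_id_le hcomp hsupp hmap hmin
  obtain ⟨δ, hδ, hδD⟩ := hQ.exists_cthickening_subset hcomp hsupp
  obtain ⟨C, hC0, hC⟩ := exists_taylor_bounds hV hQ.isOpen_D hcomp hδD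
  obtain ⟨C', hC'0, hC'⟩ := hQ.exists_phi_taylor_bounds hcomp hδD
  obtain ⟨M, hM⟩ := hcomp.exists_bound_of_continuousOn hgS
  set N := max M 1 with hN
  have hN1 : 1 ≤ N := le_max_right _ _
  have hMN : ∀ θ ∈ μ.support, ‖gradient (Q.potential μ) θ‖ ≤ N := fun θ hθ =>
    (hM θ hθ).trans (le_max_left _ _)
  have hsq : Integrable (fun θ => ‖gradient (Q.potential μ) θ‖ ^ 2) μ :=
    integrable_of_continuousOn_compact hcomp ae_mem_support (hgS.norm.pow 2)
  have hsq0 : 0 ≤ ∫ θ, ‖gradient (Q.potential μ) θ‖ ^ 2 ∂μ :=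
    integral_nonneg fun θ => by positivity
  -- the gain is `s ∫ |∇V|²`, everything else is of order `s²`
  have hcore : ∀ s, 0 < s → s * N ≤ δ → s * N ≤ ε →
      ∫ θ, ‖gradient (Q.potential μ) θ‖ ^ 2 ∂μ ≤ s * (C * N ^ 2 + 1 / 2 * (C' * N) ^ 2) := by
    intro s hs hsδ hsε
    classical
    set G : Euc k → Euc k := fun θ =>
      θ + (-s) • μ.support.piecewise (gradient (Q.potential μ)) (fun _ => 0) θ with hG
    have hGm : Measurable G := measurable_id.add
      ((hgS.measurable_piecewise continuousOn_const hcomp.measurableSet).const_smul (-s))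
    have hGS : ∀ θ ∈ μ.support, G θ = θ + (-s) • gradient (Q.potential μ) θ := fun θ hθ => by
      simp [hG, hθ]
    have hnorm : ∀ θ ∈ μ.support, ‖(-s) • gradient (Q.potential μ) θ‖ ≤ s * N := fun θ hθ => by
      rw [norm_smul, norm_neg, Real.norm_of_nonneg hs.le]
      gcongr
      exact hMN θ hθ
    have hGC : ∀ θ ∈ μ.support, G θ ∈ Metric.cthickening δ μ.support := fun θ hθ => by
      rw [hGS θ hθ]
      refine Metric.closedBall_subset_cthickening hθ δ ?_
      simpa using (hnorm θ hθ).trans hsδ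
    have hSC : ∀ᵐ θ ∂μ, θ ∈ Metric.cthickening δ μ.support := by
      filter_upwards [ae_mem_support (μ := μ)] with θ hθ
        using Metric.self_subset_cthickening _ hθ
    have h1 := hle _ hcomp.cthickening hδD G hGm hGC fun θ hθ => by
      rw [hGS θ hθ, dist_eq_norm, add_sub_cancel_left]
      exact (hnorm θ hθ).trans hsε
    have hGC' : ∀ᵐ θ ∂μ, G θ ∈ Metric.cthickening δ μ.support := by
      filter_upwards [ae_mem_support (μ := μ)] with θ hθ using hGC θ hθ
    have h2 := hQ.energy_sub_energy_id hcomp.cthickening hδD hSC hGm.aemeasurable hGC'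
    have h3 : ∫ θ, (Q.potential μ (G θ) - Q.potential μ θ) ∂μ
        ≤ ∫ θ, (-s * ‖gradient (Q.potential μ) θ‖ ^ 2 + C * (s * N) ^ 2) ∂μ := by
      refine integral_mono_ae ((hQ.integrable_potential_comp hcomp.cthickening hδD
        hGm.aemeasurable hGC').sub (hQ.integrable_potential_comp hcomp.cthickening hδD
        (aemeasurable_id (μ := μ)) hSC)) ((hsq.const_mul _).add (integrable_const _)) ?_
      filter_upwards [ae_mem_support (μ := μ)] with θ hθ
      have h4 := (abs_le.1 (hC θ hθ _ ((hnorm θ hθ).trans hsδ)).2).2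
      rw [inner_smul_right, real_inner_self_eq_norm_sq] at h4
      have h5 : C * ‖(-s) • gradient (Q.potential μ) θ‖ ^ 2 ≤ C * (s * N) ^ 2 := by
        gcongr
        exact hnorm θ hθ
      rw [hGS θ hθ]
      linarith
    rw [integral_add (hsq.const_mul _) (integrable_const _), integral_const_mul] at h3
    have h6 : (n : ℝ)⁻¹ * ∑ l, (∫ θ, (Q.phi (G θ) (Q.x l) - Q.phi θ (Q.x l)) ∂μ) ^ 2
        ≤ (C' * (s * N)) ^ 2 := by
      refine inv_mul_sum_sq_le hn fun l => abs_integral_le_of_support fun θ hθ => ?_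
      rw [hGS θ hθ]
      refine ((hC' l θ hθ _ ((hnorm θ hθ).trans hsδ)).1).trans ?_
      gcongr
      exact hnorm θ hθ
    simp only [integral_const, probReal_univ, one_smul] at h3
    have h7 : s * ∫ θ, ‖gradient (Q.potential μ) θ‖ ^ 2 ∂μ
        ≤ s * (s * (C * N ^ 2 + 1 / 2 * (C' * N) ^ 2)) := by
      nlinarith
    exact le_of_mul_le_mul_left h7 hs
  have hzero : ∫ θ, ‖gradient (Q.potential μ) θ‖ ^ 2 ∂μ ≤ 0 := by
    have hlim : Tendsto (fun s : ℝ => s * (C * N ^ 2 + 1 / 2 * (C' * N) ^ 2)) (𝓝[>] 0) (𝓝 0) := by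
      have : Tendsto (fun s : ℝ => s * (C * N ^ 2 + 1 / 2 * (C' * N) ^ 2)) (𝓝 0)
          (𝓝 (0 * (C * N ^ 2 + 1 / 2 * (C' * N) ^ 2))) := tendsto_id.mul_const _
      rw [zero_mul] at this
      exact this.mono_left nhdsWithin_le_nhds
    have hsm : Tendsto (fun s : ℝ => s * N) (𝓝[>] 0) (𝓝 0) := by
      have : Tendsto (fun s : ℝ => s * N) (𝓝 0) (𝓝 (0 * N)) := tendsto_id.mul_const _
      rw [zero_mul] at this
      exact this.mono_left nhdsWithin_le_nhds
    refine ge_of_tendsto hlim ?_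
    filter_upwards [self_mem_nhdsWithin, hsm.eventually_le_const hδ, hsm.eventually_le_const hε]
      with s h1 h2 h3 using hcore s h1 h2 h3
  have h := (integral_eq_zero_iff_of_nonneg (fun θ => by positivity) hsq).1
    (le_antisymm hzero hsq0)
  filter_upwards [h] with θ hθ
  simpa using hθ

/-- The map that translates the points of `B` by `w` and fixes the others. -/
def shiftOn (B : Set (Euc k)) (w : Euc k) (θ : Euc k) : Euc k :=
  θ + B.indicator (fun _ => w) θ

lemma measurable_shiftOn {B : Set (Euc k)} (hB : MeasurableSet B) (w : Euc k) :
    Measurable (shiftOn B w) :=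
  measurable_id.add (measurable_const.indicator hB)

lemma norm_indicator_const_le (B : Set (Euc k)) (w θ : Euc k) :
    ‖B.indicator (fun _ => w) θ‖ ≤ ‖w‖ :=
  norm_indicator_le_norm_self (fun _ => w) θ

lemma dist_shiftOn_le (B : Set (Euc k)) (w θ : Euc k) : dist (shiftOn B w θ) θ ≤ ‖w‖ := by
  rw [dist_eq_norm, shiftOn, add_sub_cancel_left]
  exact norm_indicator_const_le B w θ

lemma shiftOn_mem_cthickening {B S : Set (Euc k)} {w θ : Euc k} {δ : ℝ} (hw : ‖w‖ ≤ δ)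
    (hθ : θ ∈ S) : shiftOn B w θ ∈ Metric.cthickening δ S :=
  Metric.closedBall_subset_cthickening hθ δ ((dist_shiftOn_le B w θ).trans hw)

/-- Shifting the mass of a set along a direction of negative curvature decreases the potential. -/
lemma integral_potential_shiftOn_le (hQ : Q.Regular) (hcomp : IsCompact μ.support)
    (hsupp : μ.support ⊆ Q.D) (hstat : ∀ θ ∈ μ.support, gradient (Q.potential μ) θ = 0)
    {δ : ℝ} (hδD : Metric.cthickening δ μ.support ⊆ Q.D) {B : Set (Euc k)}
    (hB : MeasurableSet B) {v : Euc k} {c s : ℝ} (hs : ‖s • v‖ ≤ δ)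
    (hdec : ∀ η ∈ B, Q.potential μ (η + s • v) ≤
      Q.potential μ η + s * inner ℝ (gradient (Q.potential μ) η) v - c * s ^ 2) :
    ∫ θ, (Q.potential μ (shiftOn B (s • v) θ) - Q.potential μ θ) ∂μ ≤ -(c * s ^ 2) * μ.real B := by
  have h1 : ∫ θ, B.indicator (fun _ => -(c * s ^ 2)) θ ∂μ = -(c * s ^ 2) * μ.real B := by
    rw [integral_indicator_const _ hB, smul_eq_mul, mul_comm]
  rw [← h1]
  refine integral_mono_ae ((hQ.integrable_potential_comp hcomp.cthickening hδD
    (measurable_shiftOn hB _).aemeasurable ?_).sub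
    (hQ.integrable_potential_comp hcomp hsupp (aemeasurable_id (μ := μ)) ae_mem_support))
    ((integrable_const _).indicator hB) ?_
  · filter_upwards [ae_mem_support (μ := μ)] with θ hθ using shiftOn_mem_cthickening hs hθ
  · filter_upwards [ae_mem_support (μ := μ)] with θ hθ
    by_cases hθB : θ ∈ B
    · have h2 := hdec θ hθB
      rw [hstat θ hθ] at h2
      simp only [inner_zero_left, mul_zero, add_zero] at h2
      simp only [shiftOn, hθB, indicator_of_mem]
      linarith
    · simp [shiftOn, hθB]

/-- Nonnegative curvature of the potential at a point without mass: a small ball of mass `m` around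
a point of negative curvature gains order `m s²` when shifted by `s`, at the cost of a quadratic
term of order `m² s²`. -/
lemma inner_hess_nonneg_of_no_atoms (hn : 0 < n) (hQ : Q.Regular) (hcomp : IsCompact μ.support)
    (hsupp : μ.support ⊆ Q.D) {Ψ : Euc k → Euc k} (hmap : μ.map Ψ = μ)
    (hmin : Q.IsLocalMinMap μ Ψ) (hatom : ∀ θ, μ {θ} = 0) {θ : Euc k} (hθ : θ ∈ μ.support)
    (v : Euc k) : 0 ≤ inner ℝ (hess (Q.potential μ) θ v) v := by
  have hV := hQ.contDiffOn_potential μ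
  have hstat : ∀ θ ∈ μ.support, gradient (Q.potential μ) θ = 0 := fun θ hθ =>
    hQ.gradient_potential_eq_zero hn hcomp hsupp hmap hmin hθ
  by_contra! hneg
  obtain ⟨c, hc, δ₀, hδ₀, hdec⟩ := exists_quadratic_decrease hV hQ.isOpen_D (hsupp hθ) hneg
  obtain ⟨ε, hε, hle⟩ := hQ.exists_energy_id_le hcomp hsupp hmap hmin
  obtain ⟨δ, hδ, hδD⟩ := hQ.exists_cthickening_subset hcomp hsupp
  obtain ⟨C, hC0, hC⟩ := hQ.exists_phi_taylor_bounds hcomp hδD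
  -- the interaction term is at most `s² A m²` for a ball of mass `m`, so `A m < c` suffices
  set A := 1 / 2 * (C * ‖v‖) ^ 2 + 1 with hA
  have hA0 : 0 < A := by positivity
  obtain ⟨U, hUθ, hUo, hUμ⟩ := Set.exists_isOpen_lt_of_lt (μ := μ) {θ} (ENNReal.ofReal (c / A))
    (by rw [hatom]; exact ENNReal.ofReal_pos.2 (by positivity))
  obtain ⟨r₁, hr₁, hr₁U⟩ := Metric.isOpen_iff.1 hUo θ (hUθ rfl)
  set r := min r₁ δ₀ with hr
  have hr0 : 0 < r := lt_min hr₁ hδ₀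
  set B := Metric.ball θ r with hBdef
  have hBm : MeasurableSet B := measurableSet_ball
  have hBpos : 0 < μ.real B := ENNReal.toReal_pos
    ((Measure.mem_support_iff_forall _).1 hθ _ (Metric.ball_mem_nhds θ hr0)).ne' (measure_ne_top _ _)
  have hBsmall : μ.real B < c / A := by
    have h1 : μ B < ENNReal.ofReal (c / A) := lt_of_le_of_lt
      (measure_mono ((Metric.ball_subset_ball (min_le_left _ _)).trans hr₁U)) hUμ
    exact (ENNReal.lt_ofReal_iff_toReal_lt (measure_ne_top _ _)).1 h1
  obtain ⟨s, hs0, hsδ₀, hsδ, hsε⟩ : ∃ s : ℝ, 0 < s ∧ s ≤ δ₀ ∧ s * ‖v‖ ≤ δ ∧ s * ‖v‖ ≤ ε := by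
    refine ⟨min δ₀ (min δ ε / (‖v‖ + 1)), by positivity, min_le_left _ _, ?_, ?_⟩ <;>
    · calc _ ≤ min δ ε / (‖v‖ + 1) * (‖v‖ + 1) := by
            gcongr
            · exact min_le_right _ _
            · linarith
        _ = min δ ε := by field_simp
        _ ≤ _ := by simp
  have hnorm : ‖s • v‖ = s * ‖v‖ := by rw [norm_smul, Real.norm_of_nonneg hs0.le]
  have hw : ‖s • v‖ ≤ δ := hnorm.trans_le hsδ
  have h1 := hle _ hcomp.cthickening hδD (shiftOn B (s • v)) (measurable_shiftOn hBm _)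
    (fun θ hθ => shiftOn_mem_cthickening hw hθ)
    fun θ _ => (dist_shiftOn_le B _ θ).trans (hnorm.trans_le hsε)
  have h2 := hQ.energy_sub_energy_id (μ := μ) hcomp.cthickening hδD
    (by filter_upwards [ae_mem_support (μ := μ)] with θ hθ
          using Metric.self_subset_cthickening _ hθ)
    (measurable_shiftOn hBm (s • v)).aemeasurable
    (by filter_upwards [ae_mem_support (μ := μ)] with θ hθ using shiftOn_mem_cthickening hw hθ)
  have h3 := hQ.integral_potential_shiftOn_le hcomp hsupp hstat hδD hBm (c := c) hw
    fun η hη => hdec η (Metric.ball_subset_ball (min_le_right _ _) hη) s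
      ((abs_of_pos hs0).trans_le hsδ₀)
  have h4 : (n : ℝ)⁻¹ *
      ∑ l, (∫ θ, (Q.phi (shiftOn B (s • v) θ) (Q.x l) - Q.phi θ (Q.x l)) ∂μ) ^ 2
      ≤ (C * (s * ‖v‖) * μ.real B) ^ 2 := by
    refine inv_mul_sum_sq_le hn fun l => ?_
    have h5 : ∫ θ, B.indicator (fun _ => C * (s * ‖v‖)) θ ∂μ = C * (s * ‖v‖) * μ.real B := by
      rw [integral_indicator_const _ hBm, smul_eq_mul, mul_comm]
    rw [← h5]
    rw [← Real.norm_eq_abs]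
    refine norm_integral_le_of_norm_le ((integrable_const _).indicator hBm) ?_
    filter_upwards [ae_mem_support (μ := μ)] with θ hθ
    by_cases hθB : θ ∈ B
    · simp only [shiftOn, hθB, indicator_of_mem, Real.norm_eq_abs]
      exact ((hC l θ hθ _ hw).1).trans_eq (by rw [hnorm])
    · simp [shiftOn, hθB]
  have h6 : A * μ.real B < c := by
    rwa [lt_div_iff₀ hA0, mul_comm] at hBsmall
  have h7 : 0 < s ^ 2 * μ.real B := by positivity
  have h8 := mul_lt_mul_of_pos_left h6 h7
  have h9 : 0 ≤ s ^ 2 * μ.real B * μ.real B := by positivity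
  have h10 : 1 / 2 * (C * (s * ‖v‖) * μ.real B) ^ 2
      = s ^ 2 * μ.real B * (A * μ.real B) - s ^ 2 * μ.real B * μ.real B := by
    rw [hA]; ring
  linarith

/-- Nonnegative curvature of the potential when mass may be split: moving one half of a small ball
by `s` and the other half by `-s` gains order `s²`, and the fluctuation of the represented function
is of order `s²`, hence its cost of order `s⁴`. -/
lemma inner_hess_nonneg_of_localMinMeasure (hn : 0 < n) (hQ : Q.Regular)
    (hcomp : IsCompact μ.support) (hsupp : μ.support ⊆ Q.D)
    (hstat : ∀ θ ∈ μ.support, gradient (Q.potential μ) θ = 0)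
    (hmin : Q.IsLocalMinMeasure μ) {θ : Euc k} (hθ : θ ∈ μ.support)
    (v : Euc k) : 0 ≤ inner ℝ (hess (Q.potential μ) θ v) v := by
  have hV := hQ.contDiffOn_potential μ
  by_contra! hneg
  obtain ⟨c, hc, δ₀, hδ₀, hdec⟩ := exists_quadratic_decrease hV hQ.isOpen_D (hsupp hθ) hneg
  obtain ⟨ε, hε, hle⟩ := hmin
  obtain ⟨δ, hδ, hδD⟩ := hQ.exists_cthickening_subset hcomp hsupp
  obtain ⟨C, hC0, hC⟩ := hQ.exists_phi_taylor_bounds hcomp hδD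
  set B := Metric.ball θ δ₀ with hBdef
  have hBm : MeasurableSet B := measurableSet_ball
  have hBpos : 0 < μ.real B := ENNReal.toReal_pos
    ((Measure.mem_support_iff_forall _).1 hθ _ (Metric.ball_mem_nhds θ hδ₀)).ne' (measure_ne_top _ _)
  have hcore : ∀ s : ℝ, 0 < s → s ≤ δ₀ → s * ‖v‖ ≤ δ → s * ‖v‖ ≤ ε →
      c * μ.real B ≤ s ^ 2 * (1 / 2 * (C * ‖v‖ ^ 2) ^ 2) := by
    intro s hs0 hsδ₀ hsδ hsε
    have hnorm : ‖s • v‖ = s * ‖v‖ := by rw [norm_smul, Real.norm_of_nonneg hs0.le]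
    have hnorm' : ‖(-s) • v‖ = s * ‖v‖ := by rw [neg_smul, norm_neg, hnorm]
    set Gp := shiftOn B (s • v) with hGp
    set Gm := shiftOn B ((-s) • v) with hGm
    have hGpm : Measurable Gp := measurable_shiftOn hBm _
    have hGmm : Measurable Gm := measurable_shiftOn hBm _
    have hGpC : ∀ᵐ θ ∂μ, Gp θ ∈ Metric.cthickening δ μ.support := by
      filter_upwards [ae_mem_support (μ := μ)] with θ hθ
        using shiftOn_mem_cthickening (hnorm.trans_le hsδ) hθ
    have hGmC : ∀ᵐ θ ∂μ, Gm θ ∈ Metric.cthickening δ μ.support := by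
      filter_upwards [ae_mem_support (μ := μ)] with θ hθ
        using shiftOn_mem_cthickening (hnorm'.trans_le hsδ) hθ
    have hSC : ∀ᵐ θ ∂μ, θ ∈ Metric.cthickening δ μ.support := by
      filter_upwards [ae_mem_support (μ := μ)] with θ hθ
        using Metric.self_subset_cthickening _ hθ
    have hpp : Measurable fun θ => (θ, Gp θ) := measurable_id.prodMk hGpm
    have hpm : Measurable fun θ => (θ, Gm θ) := measurable_id.prodMk hGmm
    set γ : Measure (Euc k × Euc k) := (2⁻¹ : ℝ≥0∞) • μ.map (fun θ => (θ, Gp θ))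
      + (2⁻¹ : ℝ≥0∞) • μ.map (fun θ => (θ, Gm θ)) with hγ
    have hfst : γ.fst = μ := by
      rw [hγ, Measure.fst, Measure.map_add _ _ measurable_fst, Measure.map_smul, Measure.map_smul,
        Measure.map_map measurable_fst hpp, Measure.map_map measurable_fst hpm]
      simp only [Function.comp_def, Measure.map_id', ← add_smul, ENNReal.inv_two_add_inv_two,
        one_smul]
    have hsnd : γ.snd = (2⁻¹ : ℝ≥0∞) • μ.map Gp + (2⁻¹ : ℝ≥0∞) • μ.map Gm := by
      rw [hγ, Measure.snd, Measure.map_add _ _ measurable_snd, Measure.map_smul, Measure.map_smul,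
        Measure.map_map measurable_snd hpp, Measure.map_map measurable_snd hpm]
      rfl
    have hae : ∀ p : Euc k × Euc k → Prop, MeasurableSet {x | p x} → (∀ᵐ θ ∂μ, p (θ, Gp θ)) →
        (∀ᵐ θ ∂μ, p (θ, Gm θ)) → ∀ᵐ x ∂γ, p x := by
      intro p hp h1 h2
      rw [hγ, ae_add_measure_iff]
      exact ⟨Measure.ae_smul_measure ((ae_map_iff hpp.aemeasurable hp).2 h1) _,
        Measure.ae_smul_measure ((ae_map_iff hpm.aemeasurable hp).2 h2) _⟩
    have hγC : ∀ᵐ p ∂γ, p.2 ∈ Metric.cthickening δ μ.support :=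
      hae _ (measurable_snd hcomp.cthickening.measurableSet) hGpC hGmC
    have hloss := hle γ hfst (by filter_upwards [hγC] with p hp using hδD hp)
      (hae _ (measurableSet_le (by fun_prop) measurable_const)
        (Eventually.of_forall fun θ => (dist_shiftOn_le B _ θ).trans (hnorm.trans_le hsε))
        (Eventually.of_forall fun θ => (dist_shiftOn_le B _ θ).trans (hnorm'.trans_le hsε)))
    have hprob : IsProbabilityMeasure γ.snd := by
      constructor
      rw [Measure.snd_univ, ← Measure.fst_univ, hfst, measure_univ]
    have hsndC : ∀ᵐ θ ∂γ.snd, θ ∈ Metric.cthickening δ μ.support := by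
      exact (ae_map_iff (p := fun θ => θ ∈ Metric.cthickening δ μ.support)
        measurable_snd.aemeasurable hcomp.cthickening.measurableSet).2 hγC
    have hint : ∀ q : Euc k → ℝ, ContinuousOn q Q.D → ∫ θ, q θ ∂γ.snd - ∫ θ, q θ ∂μ
        = ∫ θ, (1 / 2 * (q (Gp θ) - q θ) + 1 / 2 * (q (Gm θ) - q θ)) ∂μ := by
      intro q hq
      have hp := integrable_comp_of_continuousOn hq hcomp.cthickening hδD hGpm.aemeasurable hGpC
      have hm := integrable_comp_of_continuousOn hq hcomp.cthickening hδD hGmm.aemeasurable hGmC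
      have h0 : Integrable q μ := integrable_of_continuousOn_compact hcomp.cthickening hSC
        (hq.mono hδD)
      have hmap : ∀ G : Euc k → Euc k, Measurable G →
          (∀ᵐ θ ∂μ, G θ ∈ Metric.cthickening δ μ.support) → Integrable q (μ.map G) := by
        intro G hG hGC
        have : IsProbabilityMeasure (μ.map G) := Measure.isProbabilityMeasure_map hG.aemeasurable
        exact integrable_of_continuousOn_compact hcomp.cthickening
          ((ae_map_iff hG.aemeasurable hcomp.cthickening.measurableSet).2 hGC) (hq.mono hδD)
      have hip := hmap Gp hGpm hGpC
      have hin := hmap Gm hGmm hGmC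
      have hp0 : Integrable (fun θ => q (Gp θ) - q θ) μ := hp.sub h0
      have hm0 : Integrable (fun θ => q (Gm θ) - q θ) μ := hm.sub h0
      rw [hsnd, integral_add_measure (hip.smul_measure (by simp)) (hin.smul_measure (by simp)),
        integral_smul_measure, integral_smul_measure,
        integral_map hGpm.aemeasurable hip.aestronglyMeasurable,
        integral_map hGmm.aemeasurable hin.aestronglyMeasurable,
        integral_add (hp0.const_mul _) (hm0.const_mul _), integral_const_mul,
        integral_const_mul, integral_sub hp h0, integral_sub hm h0]
      simp
      ring
    have h2 := hQ.loss_sub_loss hcomp.cthickening hδD hSC hsndC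
    have h3 : ∫ θ, Q.potential μ θ ∂γ.snd - ∫ θ, Q.potential μ θ ∂μ
        ≤ -(c * s ^ 2) * μ.real B := by
      have hV0 := hQ.integrable_potential_comp (m := μ) hcomp.cthickening hδD
        (aemeasurable_id (μ := μ)) hSC
      have hp := (hQ.integrable_potential_comp (m := μ) hcomp.cthickening hδD
        hGpm.aemeasurable hGpC).sub hV0
      have hm := (hQ.integrable_potential_comp (m := μ) hcomp.cthickening hδD
        hGmm.aemeasurable hGmC).sub hV0
      have e := integral_add (hp.const_mul (1 / 2)) (hm.const_mul (1 / 2))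
      have h4 := hQ.integral_potential_shiftOn_le hcomp hsupp hstat hδD hBm (c := c)
        (hnorm.trans_le hsδ) fun η hη => hdec η hη s ((abs_of_pos hs0).trans_le hsδ₀)
      have h5 := hQ.integral_potential_shiftOn_le hcomp hsupp hstat hδD hBm (c := c)
        (hnorm'.trans_le hsδ) fun η hη => hdec η hη (-s)
          (((abs_neg s).trans (abs_of_pos hs0)).trans_le hsδ₀)
      rw [integral_const_mul, integral_const_mul] at e
      rw [hint _ hV.continuousOn]
      refine e.trans_le ?_
      rw [neg_sq] at h5
      simp only [Pi.sub_apply, id]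
      linarith
    have h6 : (n : ℝ)⁻¹ *
        ∑ l, (∫ θ, Q.phi θ (Q.x l) ∂γ.snd - ∫ θ, Q.phi θ (Q.x l) ∂μ) ^ 2
        ≤ (C * (s * ‖v‖) ^ 2) ^ 2 := by
      refine inv_mul_sum_sq_le hn fun l => ?_
      rw [hint _ (hQ.contDiffOn_phi l).continuousOn]
      refine abs_integral_le_of_support fun θ hθ => ?_
      by_cases hθB : θ ∈ B
      · have hp := (hC l θ hθ _ (hnorm.trans_le hsδ)).2
        have hm := (hC l θ hθ _ (hnorm'.trans_le hsδ)).2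
        rw [hnorm] at hp
        rw [hnorm'] at hm
        simp only [neg_smul, inner_neg_right] at hm
        simp only [hGp, hGm, shiftOn, hθB, indicator_of_mem, neg_smul]
        rw [abs_le] at hp hm ⊢
        constructor <;> linarith [hp.1, hp.2, hm.1, hm.2]
      · simp only [hGp, hGm, shiftOn, hθB, not_false_eq_true, indicator_of_notMem, add_zero,
          sub_self, mul_zero, abs_zero]
        positivity
    have h7 : s ^ 2 * (c * μ.real B) ≤ s ^ 2 * (s ^ 2 * (1 / 2 * (C * ‖v‖ ^ 2) ^ 2)) := by
      have : 1 / 2 * (C * (s * ‖v‖) ^ 2) ^ 2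
        = s ^ 2 * (s ^ 2 * (1 / 2 * (C * ‖v‖ ^ 2) ^ 2)) := by ring
      linarith
    exact le_of_mul_le_mul_left h7 (by positivity)
  have hlim : Tendsto (fun s : ℝ => s ^ 2 * (1 / 2 * (C * ‖v‖ ^ 2) ^ 2)) (𝓝[>] 0) (𝓝 0) := by
    refine (Continuous.tendsto' (by fun_prop) 0 0 (by simp)).mono_left nhdsWithin_le_nhds
  have hsm : Tendsto (fun s : ℝ => s * ‖v‖) (𝓝[>] 0) (𝓝 0) :=
    (Continuous.tendsto' (by fun_prop) 0 0 (by simp)).mono_left nhdsWithin_le_nhds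
  have hfin : c * μ.real B ≤ 0 := by
    refine ge_of_tendsto hlim ?_
    filter_upwards [self_mem_nhdsWithin, mem_nhdsWithin_of_mem_nhds (Iic_mem_nhds hδ₀),
      hsm.eventually_le_const hδ, hsm.eventually_le_const hε]
      with s h0 h1 h2 h3 using hcore s h0 h1 h2 h3
  have : 0 < c * μ.real B := by positivity
  linarith

end Regular

end Problem

/-! ### The stationary flow and the linearized dynamics along it -/

lemma exists_lipschitzOnWith_of_isCompact_subset {k : ℕ} {F : Type*} [NormedAddCommGroup F]
    [NormedSpace ℝ F] {D C : Set (Euc k)} {f : Euc k → F} (hf : ContDiffOn ℝ 1 f D)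
    (hD : IsOpen D) (hC : IsCompact C) (hCD : C ⊆ D) : ∃ L : ℝ≥0, LipschitzOnWith L f C := by
  refine LocallyLipschitzOn.exists_lipschitzOnWith_of_compact hC fun θ hθ => ?_
  obtain ⟨L, t, ht, hL⟩ := (hf.contDiffAt (hD.mem_nhds (hCD hθ))).exists_lipschitzOnWith
  exact ⟨L, t, mem_nhdsWithin_of_mem_nhds ht, hL⟩

/-- Integration of the differential inequality `|f' t| ≤ Λ M (Λ t) ^ j / j!`. -/
lemma norm_le_pow_succ_div_factorial {E : Type*} [NormedAddCommGroup E] [NormedSpace ℝ E]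
    {f f' : ℝ → E} {τ Λ M : ℝ} {j : ℕ} (hf : ContinuousOn f (Icc 0 τ))
    (hf' : ∀ t ∈ Ico 0 τ, HasDerivWithinAt f (f' t) (Ici t) t) (h0 : f 0 = 0)
    (hbd : ∀ t ∈ Ico 0 τ, ‖f' t‖ ≤ Λ * (M * ((Λ * t) ^ j / j.factorial))) :
    ∀ t ∈ Icc 0 τ, ‖f t‖ ≤ M * ((Λ * t) ^ (j + 1) / (j + 1).factorial) := by
  refine fun t ht => image_norm_le_of_norm_deriv_right_le_deriv_boundary hf hf'
    (B := fun t => M * ((Λ * t) ^ (j + 1) / (j + 1).factorial)) (by simp [h0])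
    (B' := fun t => Λ * (M * ((Λ * t) ^ j / j.factorial))) (fun t => ?_) hbd ht
  have h := ((((hasDerivAt_id t).const_mul Λ).pow (j + 1)).div_const
    ((j + 1).factorial : ℝ)).const_mul M
  refine h.congr_deriv ?_
  have hj : (j.factorial : ℝ) ≠ 0 := by positivity
  have hj1 : (j : ℝ) + 1 ≠ 0 := by positivity
  simp only [id, Nat.factorial_succ, Nat.cast_mul, Nat.cast_add, Nat.cast_one, mul_one,
    add_tsub_cancel_right]
  field_simp

namespace Problem

variable {k d n : ℕ} {Q : Problem k d n} {μ : Measure (Euc k)}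

/-- The feature `φ(·, x_l)` as a continuous function on the support. -/
def Regular.feature (hQ : Q.Regular) (hsupp : μ.support ⊆ Q.D) (l : Fin n) : C(μ.support, ℝ) :=
  ⟨fun θ => Q.phi θ (Q.x l), continuousOn_iff_continuous_domRestrict.1
    ((hQ.contDiffOn_phi l).continuousOn.mono hsupp)⟩

/-- The gradient `∇φ(·, x_l)` of a feature. -/
def featureGrad (Q : Problem k d n) (l : Fin n) : Euc k → Euc k :=
  gradient fun η => Q.phi η (Q.x l)

lemma Regular.testInt_phi (hQ : Q.Regular) (hsupp : μ.support ⊆ Q.D)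
    (w : C(μ.support, ℝ) →ₗ[ℝ] ℝ) (l : Fin n) :
    testInt w (fun θ => Q.phi θ (Q.x l)) = w (hQ.feature hsupp l) :=
  dif_pos (hQ.feature hsupp l).continuous

lemma Regular.testIntVec_gradK (hQ : Q.Regular) (hsupp : μ.support ⊆ Q.D)
    (w : C(μ.support, ℝ) →ₗ[ℝ] ℝ) {θ : Euc k} (hθ : θ ∈ Q.D) :
    testIntVec w (fun θ' : μ.support => Q.gradK θ θ')
      = (n : ℝ)⁻¹ • ∑ l, w (hQ.feature hsupp l) • Q.featureGrad l θ := by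
  ext i
  have e : (fun s : μ.support => Q.gradK θ s i)
      = ⇑(∑ l, ((n : ℝ)⁻¹ * Q.featureGrad l θ i) • hQ.feature hsupp l) := by
    ext s
    rw [hQ.gradK_eq hθ]
    simp only [WithLp.ofLp_sum, WithLp.ofLp_smul, Finset.sum_apply, Pi.smul_apply,
      smul_eq_mul, ContinuousMap.coe_sum, ContinuousMap.coe_smul]
    refine Finset.sum_congr rfl fun l _ => ?_
    have h : hQ.feature hsupp l s = Q.phi s (Q.x l) := rfl
    rw [h, featureGrad]
    ring
  have h1 : testIntVec w (fun θ' : μ.support => Q.gradK θ θ') i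
      = testInt w (fun s : μ.support => Q.gradK θ s i) := rfl
  rw [h1, e, testInt, dif_pos (ContinuousMap.continuous _)]
  change w (∑ l, ((n : ℝ)⁻¹ * Q.featureGrad l θ i) • hQ.feature hsupp l) = _
  simp only [map_sum, map_smul, PiLp.smul_apply, WithLp.ofLp_sum, Finset.sum_apply, smul_eq_mul,
    Finset.mul_sum]
  exact Finset.sum_congr rfl fun l _ => by ring

/-- Along a flow that does not move, the fluctuation at the data points is the response of the
linearized system. -/
lemma Regular.normSq_g_eq (hQ : Q.Regular) (hsupp : μ.support ⊆ Q.D) {Θ T : ℝ → Euc k → Euc k}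
    (w : C(μ.support, ℝ) →ₗ[ℝ] ℝ) (hid : ∀ t, 0 ≤ t → ∀ θ ∈ μ.support, Θ t θ = θ)
    {t : ℝ} (ht : 0 ≤ t) :
    Q.normSq (Q.g μ Θ w T t) = (n : ℝ)⁻¹ *
      ∑ l, response μ Q.featureGrad (fun l => w (hQ.feature hsupp l)) (T t) l ^ 2 := by
  rw [normSq_eq]
  congr 1
  refine Finset.sum_congr rfl fun l _ => ?_
  congr 1
  rw [g, response, ← hQ.testInt_phi hsupp]
  congr 1
  · congr 1
    ext1 s
    rw [hid t ht s s.2]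
  · refine integral_congr_ae ?_
    filter_upwards [ae_mem_support (μ := μ)] with θ hθ
    rw [hid t ht θ hθ]
    rfl

variable [IsProbabilityMeasure μ]

/-- A characteristic flow started from a stationary measure does not move. -/
lemma IsCharFlow.eq_self {Θ : ℝ → Euc k → Euc k} (hΘ : Q.IsCharFlow μ Θ) (hQ : Q.Regular)
    (hcomp : IsCompact μ.support) (hsupp : μ.support ⊆ Q.D)
    (hstat : ∀ θ ∈ μ.support, gradient (Q.potential μ) θ = 0) {τ : ℝ} (hτ : 0 ≤ τ)
    {θ : Euc k} (hθ : θ ∈ μ.support) : Θ τ θ = θ := by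
  have hcontΘ : ContinuousOn (fun p : ℝ × Euc k => Θ p.1 p.2) (Icc 0 τ ×ˢ μ.support) :=
    hΘ.cont.mono (prod_mono_left fun _ h => h.1)
  have hKc : IsCompact (Icc (0 : ℝ) τ ×ˢ μ.support) := isCompact_Icc.prod hcomp
  set C : Set (Euc k) := (fun p : ℝ × Euc k => Θ p.1 p.2) '' (Icc 0 τ ×ˢ μ.support) with hCdef
  have hC : IsCompact C := hKc.image_of_continuousOn hcontΘ
  have hCD : C ⊆ Q.D := by
    rintro _ ⟨p, ⟨h1, h2⟩, rfl⟩
    exact hΘ.mem _ h1.1 _ h2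
  have hmemC : ∀ t ∈ Icc 0 τ, ∀ θ ∈ μ.support, Θ t θ ∈ C := fun t ht θ hθ =>
    ⟨(t, θ), ⟨ht, hθ⟩, rfl⟩
  have hSC : μ.support ⊆ C := fun θ hθ => by
    have := hmemC 0 ⟨le_rfl, hτ⟩ θ hθ
    rwa [hΘ.init θ hθ] at this
  obtain ⟨L, hL⟩ := exists_lipschitzOnWith_of_isCompact_subset
    ((hQ.contDiffOn_potential μ).gradient_one hQ.isOpen_D) hQ.isOpen_D hC hCD
  choose L' hL' using fun l => exists_lipschitzOnWith_of_isCompact_subset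
    ((hQ.contDiffOn_phi l).of_le one_le_two) hQ.isOpen_D hC hCD
  choose A hA using fun l => hC.exists_bound_of_continuousOn
    (((hQ.contDiffOn_phi l).gradient_one hQ.isOpen_D).continuousOn.mono hCD)
  obtain ⟨M, hM⟩ := hKc.exists_bound_of_continuousOn (hcontΘ.sub continuousOn_snd)
  set Λ : ℝ := L + ∑ l, (n : ℝ)⁻¹ * L' l * A l with hΛ
  have hΘm : ∀ t ∈ Icc 0 τ, AEMeasurable (Θ t) μ := fun t ht =>
    (integrable_of_continuousOn_compact hcomp ae_mem_support
      (hΘ.cont.slice ht.1)).aestronglyMeasurable.aemeasurable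
  have hi0 : ∀ l, Integrable (fun θ => Q.phi θ (Q.x l)) μ :=
    hQ.integrable_phi_comp hcomp hsupp aemeasurable_id ae_mem_support
  -- the velocity is bounded by the largest displacement
  have hvel : ∀ t ∈ Icc 0 τ, ∀ β : ℝ, (∀ θ ∈ μ.support, ‖Θ t θ - θ‖ ≤ β) →
      ∀ θ ∈ μ.support, ‖-Q.gradV μ (Θ t) (Θ t θ)‖ ≤ Λ * β := by
    intro t ht β hβ θ hθ
    have hβ0 : 0 ≤ β := (norm_nonneg _).trans (hβ θ hθ)
    have hD := hCD (hmemC t ht θ hθ)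
    have hi := hQ.integrable_phi_comp hC hCD (hΘm t ht)
      (by filter_upwards [ae_mem_support (μ := μ)] with θ hθ using hmemC t ht θ hθ)
    have e : Q.gradV μ (Θ t) (Θ t θ) = gradient (Q.potential μ) (Θ t θ)
        + ∑ l, ((n : ℝ)⁻¹ * ∫ θ', (Q.phi (Θ t θ') (Q.x l) - Q.phi θ' (Q.x l)) ∂μ) •
          gradient (fun η => Q.phi η (Q.x l)) (Θ t θ) := by
      rw [hQ.gradV_eq hD hi, hQ.gradient_potential hD, add_assoc, ← Finset.sum_add_distrib]
      congr 1
      refine Finset.sum_congr rfl fun l _ => ?_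
      rw [integral_sub (hi l) (hi0 l), ← add_smul, f]
      congr 1
      ring
    rw [norm_neg, e, hΛ, add_mul, Finset.sum_mul]
    refine (norm_add_le _ _).trans (add_le_add ?_ ((norm_sum_le _ _).trans
      (Finset.sum_le_sum fun l _ => ?_)))
    · have h1 := hL.norm_sub_le (hmemC t ht θ hθ) (hSC hθ)
      rw [hstat θ hθ, sub_zero] at h1
      exact h1.trans (by gcongr; exact hβ θ hθ)
    · have h2 : |∫ θ', (Q.phi (Θ t θ') (Q.x l) - Q.phi θ' (Q.x l)) ∂μ| ≤ L' l * β := by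
        refine Regular.abs_integral_le_of_support fun θ' hθ' => ?_
        exact ((hL' l).norm_sub_le (hmemC t ht θ' hθ') (hSC hθ')).trans
          (by gcongr; exact hβ θ' hθ')
      rw [norm_smul, norm_mul, Real.norm_of_nonneg (by positivity : (0 : ℝ) ≤ (n : ℝ)⁻¹),
        Real.norm_eq_abs]
      calc _ ≤ (n : ℝ)⁻¹ * (L' l * β) * A l := by
            gcongr
            exact hA l _ (hmemC t ht θ hθ)
        _ = _ := by ring
  have hiter : ∀ j : ℕ, ∀ t ∈ Icc 0 τ, ∀ θ ∈ μ.support,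
      ‖Θ t θ - θ‖ ≤ M * ((Λ * t) ^ j / j.factorial) := by
    intro j
    induction j with
    | zero =>
      intro t ht θ hθ
      simpa using hM (t, θ) ⟨ht, hθ⟩
    | succ j ih =>
      intro t ht θ hθ
      refine norm_le_pow_succ_div_factorial (f := fun t => Θ t θ - θ)
        (f' := fun t => -Q.gradV μ (Θ t) (Θ t θ)) ?_ (fun s hs => ?_) ?_ (fun s hs => ?_) t ht
      · exact (hcontΘ.comp (f := fun t => (t, θ)) (by fun_prop) fun s hs => ⟨hs, hθ⟩).sub
          continuousOn_const
      · exact ((hΘ.ode θ hθ s hs.1).mono (Ici_subset_Ici.2 hs.1)).sub_const θ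
      · simp [hΘ.init θ hθ]
      · exact hvel s ⟨hs.1, hs.2.le⟩ _ (ih s ⟨hs.1, hs.2.le⟩) θ hθ
  have hlim : Tendsto (fun j : ℕ => M * ((Λ * τ) ^ j / j.factorial)) atTop (𝓝 (M * 0)) :=
    (FloorSemiring.tendsto_pow_div_factorial_atTop (Λ * τ)).const_mul M
  rw [mul_zero] at hlim
  have h := ge_of_tendsto' hlim fun j => hiter j τ ⟨hτ, le_rfl⟩ θ hθ
  exact sub_eq_zero.1 (norm_le_zero_iff.1 h)

/-- The linearized system at a stationary measure with nonnegative curvature. -/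
lemma Regular.isLinearizedSystem (hn : 0 < n) (hQ : Q.Regular) (hcomp : IsCompact μ.support)
    (hsupp : μ.support ⊆ Q.D)
    (hcurv : ∀ θ ∈ μ.support, ∀ v, 0 ≤ inner ℝ (hess (Q.potential μ) θ v) v) :
    IsLinearizedSystem μ μ.support (n : ℝ)⁻¹ (hess (Q.potential μ)) Q.featureGrad where
  isProb := inferInstance
  isCompact := hcomp
  ae_mem := ae_mem_support
  c_pos := by positivity
  H_cont := ((hQ.contDiffOn_potential μ).continuousOn_hess hQ.isOpen_D).mono hsupp
  H_symm θ hθ v w := inner_hess_left (hQ.contDiffOn_potential μ) hQ.isOpen_D (hsupp hθ) v w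
  H_nonneg := hcurv
  a_cont l := ((hQ.contDiffOn_phi l).gradient_one hQ.isOpen_D).continuousOn.mono hsupp

/-- Along a flow that does not move, the tangent flow has constant coefficients. -/
lemma IsTangentFlow.isLinearizedFlow {Θ T : ℝ → Euc k → Euc k} {w : C(μ.support, ℝ) →ₗ[ℝ] ℝ}
    (hT : Q.IsTangentFlow μ Θ w T) (hQ : Q.Regular) (hcomp : IsCompact μ.support)
    (hsupp : μ.support ⊆ Q.D) (hid : ∀ t, 0 ≤ t → ∀ θ ∈ μ.support, Θ t θ = θ) :
    IsLinearizedFlow μ μ.support (n : ℝ)⁻¹ (hess (Q.potential μ)) Q.featureGrad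
      (fun l => w (hQ.feature hsupp l)) T where
  cont := hT.cont
  init := hT.init
  ode θ hθ t ht := by
    refine (hT.ode θ hθ t ht).congr_deriv ?_
    have hθD := hsupp hθ
    have hidae : ∀ᵐ θ' ∂μ, Θ t θ' = θ' := by
      filter_upwards [ae_mem_support (μ := μ)] with θ' hθ' using hid t ht θ' hθ'
    have hi0 : ∀ l, Integrable (fun θ => Q.phi θ (Q.x l)) μ :=
      hQ.integrable_phi_comp hcomp hsupp aemeasurable_id ae_mem_support
    have hi : ∀ l, Integrable (fun θ' => Q.phi (Θ t θ') (Q.x l)) μ := fun l =>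
      (hi0 l).congr (by filter_upwards [hidae] with θ' h; rw [h])
    have e1 : Q.hessV μ (Θ t) (Θ t θ) = hess (Q.potential μ) θ := by
      rw [hid t ht θ hθ, hQ.hessV_eq hθD hi, hQ.hess_potential hθD]
      congr 1
      refine Finset.sum_congr rfl fun l _ => ?_
      congr 2
      refine integral_congr_ae ?_
      filter_upwards [hidae] with θ' h
      rw [h]
    have e2 : ∫ θ', Q.mixedK (Θ t θ) (Θ t θ') (T t θ') ∂μ
        = (n : ℝ)⁻¹ • ∑ l, (∫ θ', inner ℝ (Q.featureGrad l θ') (T t θ') ∂μ) •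
          Q.featureGrad l θ := by
      have hia : ∀ l, Integrable (fun θ' => (inner ℝ (Q.featureGrad l θ') (T t θ') : ℝ)) μ :=
        fun l => integrable_of_continuousOn_compact hcomp ae_mem_support
          ((((hQ.contDiffOn_phi l).gradient_one hQ.isOpen_D).continuousOn.mono hsupp).inner
            (hT.cont.slice ht))
      simp only [← integral_smul_const]
      rw [← integral_finsetSum _ fun l _ => (hia l).smul_const _, ← integral_smul]
      refine integral_congr_ae ?_
      filter_upwards [hidae, ae_mem_support (μ := μ)] with θ' h hθ'
      rw [h, hid t ht θ hθ, hQ.mixedK_apply hθD (hsupp hθ')]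
      rfl
    have e3 : testIntVec w (fun θ' : μ.support => Q.gradK (Θ t θ) (Θ t θ'))
        = (n : ℝ)⁻¹ • ∑ l, w (hQ.feature hsupp l) • Q.featureGrad l θ := by
      rw [← hQ.testIntVec_gradK hsupp w hθD]
      congr 1
      ext1 s
      rw [hid t ht θ hθ, hid t ht s s.2]
    rw [e1, e2, e3, quadVelocity, sub_sub, ← smul_add, ← Finset.sum_add_distrib]
    simp only [response, ← add_smul]
    congr 2
    exact Finset.sum_congr rfl fun l _ => by rw [add_comm]

end Problem

/-! ### Expectations and time averages -/

/-- A real quantity that is a `1`-Lipschitz function of a random vector on a set of full measure is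
measurable up to null sets. No measurability of the quantity itself is assumed. -/
lemma aestronglyMeasurable_of_dist_le {Ξ : Type*} [MeasurableSpace Ξ] {P : Measure Ξ}
    {α : Type*} [PseudoMetricSpace α] [MeasurableSpace α] [OpensMeasurableSpace α] {β : Ξ → α}
    (hβ : AEMeasurable β P) {ρ : Ξ → ℝ} {G : Set Ξ} (hG : ∀ᵐ ξ ∂P, ξ ∈ G)
    (h : ∀ ξ ∈ G, ∀ ξ' ∈ G, dist (ρ ξ) (ρ ξ') ≤ dist (β ξ) (β ξ')) :
    AEStronglyMeasurable ρ P := by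
  classical
  set f : α → ℝ := fun y => if hy : ∃ ξ ∈ G, β ξ = y then ρ hy.choose else 0 with hf
  have hspec : ∀ y, (hy : ∃ ξ ∈ G, β ξ = y) → ∃ ξ ∈ G, β ξ = y ∧ f y = ρ ξ := fun y hy =>
    ⟨hy.choose, hy.choose_spec.1, hy.choose_spec.2, by simp [hf, hy]⟩
  have hlip : LipschitzOnWith 1 f (β '' G) := by
    refine LipschitzOnWith.of_dist_le_mul fun y hy z hz => ?_
    obtain ⟨ξ, hξ, rfl, e1⟩ := hspec y hy
    obtain ⟨ξ', hξ', rfl, e2⟩ := hspec z hz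
    rw [e1, e2, NNReal.coe_one, one_mul]
    exact h ξ hξ ξ' hξ'
  obtain ⟨F, hF, hFf⟩ := hlip.extend_real
  refine (hF.continuous.measurable.comp_aemeasurable hβ).aestronglyMeasurable.congr ?_
  filter_upwards [hG] with ξ hξ
  obtain ⟨ξ', hξ', e, e'⟩ := hspec (β ξ) ⟨ξ, hξ, rfl⟩
  have h0 : dist (ρ ξ') (ρ ξ) ≤ 0 := (h ξ' hξ' ξ hξ).trans_eq (by rw [e, dist_self])
  rw [Function.comp_apply, ← hFf ⟨ξ, hξ, rfl⟩, e', dist_le_zero.1 h0]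

/-- The time averages of a bounded continuous function with a limit have the same limit. -/
lemma tendsto_timeAverage {m : ℝ → ℝ} {ℓ C : ℝ} (hm : ContinuousOn m (Ici 0))
    (hb : ∀ t, 0 ≤ t → |m t| ≤ C) (hlim : Tendsto m atTop (𝓝 ℓ)) :
    Tendsto (fun τ : ℝ => (1 / τ) * ∫ t in (0 : ℝ)..τ, m t) atTop (𝓝 ℓ) := by
  have h1 : Tendsto (fun τ : ℝ => ∫ u in (0 : ℝ)..1, m (τ * u)) atTop
      (𝓝 (∫ _ in (0 : ℝ)..1, ℓ)) := by
    refine intervalIntegral.tendsto_integral_filter_of_dominated_convergence (fun _ => C) ?_ ?_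
      (by simp) ?_
    · filter_upwards [eventually_ge_atTop 0] with τ hτ
      refine ContinuousOn.aestronglyMeasurable ?_ measurableSet_uIoc
      refine hm.comp (by fun_prop) fun u hu => ?_
      rw [uIoc_of_le zero_le_one] at hu
      exact mul_nonneg hτ hu.1.le
    · filter_upwards [eventually_ge_atTop 0] with τ hτ
      refine Eventually.of_forall fun u hu => ?_
      rw [uIoc_of_le zero_le_one] at hu
      exact hb _ (mul_nonneg hτ hu.1.le)
    · refine Eventually.of_forall fun u hu => ?_
      rw [uIoc_of_le zero_le_one] at hu
      exact hlim.comp (tendsto_id.atTop_mul_const hu.1)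
  simp only [intervalIntegral.integral_const, sub_zero, one_smul] at h1
  refine h1.congr' ?_
  filter_upwards [eventually_gt_atTop 0] with τ hτ
  rw [intervalIntegral.integral_comp_mul_left _ hτ.ne']
  simp

/-- A family of random variables with continuous convergent paths, dominated by one integrable
variable, has a time-averaged expectation, at most the expectation of the dominating variable. -/
lemma exists_tendsto_average_of_dominated {Ξ : Type*} [MeasurableSpace Ξ] {P : Measure Ξ}
    {X : ℝ → Ξ → ℝ} {Y : Ξ → ℝ} (hY : Integrable Y P)
    (hmeas : ∀ t, 0 ≤ t → AEStronglyMeasurable (X t) P)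
    (h0 : ∀ t ξ, 0 ≤ X t ξ) (hle : ∀ᵐ ξ ∂P, ∀ t, 0 ≤ t → X t ξ ≤ Y ξ)
    (hcont : ∀ᵐ ξ ∂P, ContinuousOn (fun t => X t ξ) (Ici 0))
    (hlim : ∀ᵐ ξ ∂P, ∃ γ, Tendsto (fun t => X t ξ) atTop (𝓝 γ)) :
    (∀ t, 0 ≤ t → Integrable (X t) P) ∧
    (∀ τ, 0 ≤ τ → IntervalIntegrable (fun t => ∫ ξ, X t ξ ∂P) volume 0 τ) ∧
    ∃ ℓ, Tendsto (fun τ : ℝ => (1 / τ) * ∫ t in (0 : ℝ)..τ, ∫ ξ, X t ξ ∂P) atTop (𝓝 ℓ) ∧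
      ℓ ≤ ∫ ξ, Y ξ ∂P := by
  have hbd : ∀ t, 0 ≤ t → ∀ᵐ ξ ∂P, ‖X t ξ‖ ≤ Y ξ := fun t ht => by
    filter_upwards [hle] with ξ h
    rw [Real.norm_of_nonneg (h0 t ξ)]
    exact h t ht
  have hint : ∀ t, 0 ≤ t → Integrable (X t) P := fun t ht => hY.mono' (hmeas t ht) (hbd t ht)
  have hm : ContinuousOn (fun t => ∫ ξ, X t ξ ∂P) (Ici 0) := by
    intro t ht
    refine continuousWithinAt_of_dominated (bound := Y) ?_ ?_ hY ?_
    · filter_upwards [self_mem_nhdsWithin] with s hs using hmeas s hs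
    · filter_upwards [self_mem_nhdsWithin] with s hs using hbd s hs
    · filter_upwards [hcont] with ξ h using h t ht
  have hmb : ∀ t, 0 ≤ t → ∫ ξ, X t ξ ∂P ≤ ∫ ξ, Y ξ ∂P := fun t ht =>
    integral_mono_ae (hint t ht) hY (by filter_upwards [hle] with ξ h using h t ht)
  refine ⟨hint, fun τ hτ => ?_, ?_⟩
  · refine (hm.mono ?_).intervalIntegrable
    rw [uIcc_of_le hτ]
    exact Icc_subset_Ici_self
  · have hlim' : ∀ ξ, ∃ γ, (∃ γ, Tendsto (fun t => X t ξ) atTop (𝓝 γ)) →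
        Tendsto (fun t => X t ξ) atTop (𝓝 γ) := fun ξ => by
      by_cases h : ∃ γ, Tendsto (fun t => X t ξ) atTop (𝓝 γ)
      · exact ⟨h.choose, fun _ => h.choose_spec⟩
      · exact ⟨0, fun h' => absurd h' h⟩
    choose γ hγ using hlim'
    have hl : Tendsto (fun t => ∫ ξ, X t ξ ∂P) atTop (𝓝 (∫ ξ, γ ξ ∂P)) := by
      refine tendsto_integral_filter_of_dominated_convergence Y ?_ ?_ hY ?_
      · filter_upwards [eventually_ge_atTop 0] with t ht using hmeas t ht
      · filter_upwards [eventually_ge_atTop 0] with t ht using hbd t ht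
      · filter_upwards [hlim] with ξ h using hγ ξ h
    refine ⟨_, tendsto_timeAverage hm (C := ∫ ξ, Y ξ ∂P) (fun t ht => ?_) hl, ?_⟩
    · rw [abs_of_nonneg (integral_nonneg (h0 t))]
      exact hmb t ht
    · refine le_of_tendsto hl ?_
      filter_upwards [eventually_ge_atTop 0] with t ht using hmb t ht

namespace Problem

variable {k d n : ℕ} {Q : Problem k d n} {μ : Measure (Euc k)} [IsProbabilityMeasure μ]

/-- The expected squared size of the initial fluctuation of the represented function. -/
lemma integral_initial_fluctuation (hQ : Q.Regular) (hcomp : IsCompact μ.support)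
    (hsupp : μ.support ⊆ Q.D) {Ξ : Type*} [MeasurableSpace Ξ] {P : Measure Ξ}
    {ω₀ : Ξ → C(μ.support, ℝ) →ₗ[ℝ] ℝ} (hω₀ : IsInitialFluctuation P μ ω₀) :
    Integrable (fun ξ => (n : ℝ)⁻¹ * ∑ l, ω₀ ξ (hQ.feature hsupp l) ^ 2) P ∧
    ∫ ξ, (n : ℝ)⁻¹ * ∑ l, ω₀ ξ (hQ.feature hsupp l) ^ 2 ∂P
      = (∫ θ, Q.normSq (Q.phi θ) ∂μ) - Q.normSq (Q.f μ) := by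
  have hi : ∀ l, Integrable (fun ξ => ω₀ ξ (hQ.feature hsupp l) ^ 2) P := fun l =>
    (hω₀.gaussian.hasGaussianLaw_eval (hQ.feature hsupp l)).memLp_two.integrable_sq
  refine ⟨(integrable_finsetSum _ fun l _ => hi l).const_mul _, ?_⟩
  have hsub : ∀ q : Euc k → ℝ, ∫ θ : μ.support, q θ ∂(μ.comap Subtype.val) = ∫ θ, q θ ∂μ := by
    intro q
    rw [integral_subtype_comap hcomp.measurableSet, Measure.restrict_eq_self_of_ae_mem
      ae_mem_support]
  have hsq : ∀ l, Integrable (fun θ => Q.phi θ (Q.x l) ^ 2) μ := fun l =>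
    integrable_of_continuousOn_compact hcomp ae_mem_support
      (((hQ.contDiffOn_phi l).continuousOn.mono hsupp).pow 2)
  have hcov : ∀ l, ∫ ξ, ω₀ ξ (hQ.feature hsupp l) ^ 2 ∂P
      = ∫ θ, Q.phi θ (Q.x l) ^ 2 ∂μ - Q.f μ (Q.x l) ^ 2 := fun l => by
    have h := hω₀.covariance (hQ.feature hsupp l) (hQ.feature hsupp l)
    have e1 := hsub fun θ => Q.phi θ (Q.x l) * Q.phi θ (Q.x l)
    have e2 := hsub fun θ => Q.phi θ (Q.x l)
    simp only [pow_two]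
    refine h.trans ?_
    rw [f, ← e1, ← e2]
    rfl
  rw [integral_const_mul, integral_finsetSum _ fun l _ => hi l]
  simp only [hcov, normSq_eq]
  rw [integral_const_mul, integral_finsetSum _ fun l _ => hsq l, Finset.sum_sub_distrib, mul_sub]

end Problem

/-! ### The asymptotic fluctuation bound -/

/-- The response depends on the initial fluctuation in a `1`-Lipschitz way. -/
lemma IsLinearizedFlow.dist_norm_response_le {k n : ℕ} {μ : Measure (Euc k)} {S : Set (Euc k)}
    {c : ℝ} {H : Euc k → Euc k →L[ℝ] Euc k} {a : Fin n → Euc k → Euc k} {b b' : Fin n → ℝ}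
    {T T' : ℝ → Euc k → Euc k} (hL : IsLinearizedSystem μ S c H a)
    (hT : IsLinearizedFlow μ S c H a b T) (hT' : IsLinearizedFlow μ S c H a b' T')
    {t : ℝ} (ht : 0 ≤ t) :
    dist ‖(WithLp.toLp 2 (response μ a b (T t)) : Euc n)‖
      ‖(WithLp.toLp 2 (response μ a b' (T' t)) : Euc n)‖
      ≤ dist (WithLp.toLp 2 b : Euc n) (WithLp.toLp 2 b') := by
  refine (dist_norm_norm_le _ _).trans ?_
  rw [dist_eq_norm, EuclideanSpace.norm_eq, EuclideanSpace.norm_eq]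
  refine Real.sqrt_le_sqrt ?_
  have h := (IsLinearizedFlow.sub hL hT hT').sum_response_sq_le hL ht
  simp only [hL.response_sub (hT.continuousOn_slice ht) (hT'.continuousOn_slice ht)] at h
  simpa using h

end

theorem theorem2 {k d n : ℕ} (hn : 0 < n) (Q : Problem k d n) (hQ : Q.Regular)
    -- the initial measure: a compactly supported probability measure on `D`
    (μ₀ : Measure (Euc k)) [IsProbabilityMeasure μ₀]
    (hcomp : IsCompact μ₀.support) (hsupp : μ₀.support ⊆ Q.D)
    -- the characteristic flow exists for all times and converges
    (Θ : ℝ → Euc k → Euc k) (hΘ : Q.IsCharFlow μ₀ Θ)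
    (Θinf : Euc k → Euc k)
    (hlim : ∀ᵐ θ ∂μ₀, Tendsto (fun t => Θ t θ) atTop (𝓝 (Θinf θ)))
    -- the limiting measure, and initialization from it
    (μinf : Measure (Euc k)) (hμinf : μinf = μ₀.map Θinf) (hinit : μ₀ = μinf)
    -- the limiting map is a local minimizer of the energy; if `μinf` has atoms, local
    -- minimality is also required against perturbations that split them
    (hmin : Q.IsLocalMinMap μ₀ Θinf)
    (hatoms : (∀ θ, μinf {θ} = 0) ∨ Q.IsLocalMinMeasure μinf)
    -- the Gaussian initial fluctuation and the linearized flow that it drives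
    {Ξ : Type*} [MeasurableSpace Ξ] (P : Measure Ξ) [IsProbabilityMeasure P]
    (ω₀ : Ξ → C(μ₀.support, ℝ) →ₗ[ℝ] ℝ) (hω₀ : IsInitialFluctuation P μ₀ ω₀)
    (T : Ξ → ℝ → Euc k → Euc k)
    (hT : ∀ᵐ ξ ∂P, Q.IsTangentFlow μ₀ Θ (ω₀ ξ) (T ξ)) :
    (∀ t, 0 ≤ t → Integrable (fun ξ => Q.normSq (Q.g μ₀ Θ (ω₀ ξ) (T ξ) t)) P) ∧
    (∀ τ, 0 ≤ τ → IntervalIntegrable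
      (fun t => ∫ ξ, Q.normSq (Q.g μ₀ Θ (ω₀ ξ) (T ξ) t) ∂P) volume 0 τ) ∧
    ∃ ℓ : ℝ,
      Tendsto (fun τ : ℝ => (1 / τ) *
        ∫ t in (0 : ℝ)..τ, ∫ ξ, Q.normSq (Q.g μ₀ Θ (ω₀ ξ) (T ξ) t) ∂P) atTop (𝓝 ℓ) ∧
      ℓ ≤ (∫ θ, Q.normSq (Q.phi θ) ∂μinf) - Q.normSq (Q.f μinf) := by

  subst hμinf
  have hmap : μ₀.map Θinf = μ₀ := hinit.symm
  rw [hmap] at hatoms ⊢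
  have hstat : ∀ θ ∈ μ₀.support, gradient (Q.potential μ₀) θ = 0 := fun θ hθ =>
    hQ.gradient_potential_eq_zero hn hcomp hsupp hmap hmin hθ
  have hcurv : ∀ θ ∈ μ₀.support, ∀ v, 0 ≤ inner ℝ (hess (Q.potential μ₀) θ v) v :=
    fun θ hθ v => hatoms.elim
      (fun h => hQ.inner_hess_nonneg_of_no_atoms hn hcomp hsupp hmap hmin h hθ v)
      fun h => hQ.inner_hess_nonneg_of_localMinMeasure hn hcomp hsupp hstat h hθ v
  have hid : ∀ t, 0 ≤ t → ∀ θ ∈ μ₀.support, Θ t θ = θ := fun t ht θ hθ =>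
    hΘ.eq_self hQ hcomp hsupp hstat ht hθ
  have hL := hQ.isLinearizedSystem hn hcomp hsupp hcurv
  obtain ⟨hY, hYint⟩ := Problem.integral_initial_fluctuation hQ hcomp hsupp hω₀
  set b : Ξ → Fin n → ℝ := fun ξ l => ω₀ ξ (hQ.feature hsupp l) with hb
  have hflow : ∀ ξ, Q.IsTangentFlow μ₀ Θ (ω₀ ξ) (T ξ) → IsLinearizedFlow μ₀ μ₀.support (n : ℝ)⁻¹
      (hess (Q.potential μ₀)) Q.featureGrad (b ξ) (T ξ) := fun ξ h =>
    h.isLinearizedFlow hQ hcomp hsupp hid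
  have hg : ∀ ξ t, 0 ≤ t → Q.normSq (Q.g μ₀ Θ (ω₀ ξ) (T ξ) t)
      = (n : ℝ)⁻¹ * ∑ l, response μ₀ Q.featureGrad (b ξ) (T ξ t) l ^ 2 := fun ξ t ht =>
    hQ.normSq_g_eq hsupp (ω₀ ξ) hid ht
  rw [← hYint]
  refine exists_tendsto_average_of_dominated
    (X := fun t ξ => Q.normSq (Q.g μ₀ Θ (ω₀ ξ) (T ξ) t)) hY ?_ ?_ ?_ ?_ ?_
  · intro t ht
    have hβ : AEMeasurable (fun ξ => (WithLp.toLp 2 (b ξ) : Euc n)) P :=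
      (by fun_prop : Measurable fun u : Fin n → ℝ => (WithLp.toLp 2 u : Euc n)).comp_aemeasurable
        (aemeasurable_pi_lambda _ fun l => hω₀.gaussian.aemeasurable (hQ.feature hsupp l))
    have h := aestronglyMeasurable_of_dist_le hβ hT
      (ρ := fun ξ => ‖(WithLp.toLp 2 (response μ₀ Q.featureGrad (b ξ) (T ξ t)) : Euc n)‖)
      fun ξ hξ ξ' hξ' => (hflow ξ hξ).dist_norm_response_le hL (hflow ξ' hξ') ht
    refine ((h.pow 2).const_mul (n : ℝ)⁻¹).congr (Eventually.of_forall fun ξ => ?_)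
    simp [hg ξ t ht, EuclideanSpace.norm_sq_eq]
  · intro t ξ
    rw [Q.normSq_eq]
    positivity
  · filter_upwards [hT] with ξ hξ t ht
    rw [hg ξ t ht]
    gcongr (n : ℝ)⁻¹ * ?_
    exact (hflow ξ hξ).sum_response_sq_le hL ht
  · filter_upwards [hT] with ξ hξ
    refine ContinuousOn.congr ?_ fun t ht => hg ξ t ht
    exact continuousOn_const.mul (continuousOn_finsetSum _ fun l _ =>
      ((hflow ξ hξ).continuousOn_response hL l).pow 2)
  · filter_upwards [hT] with ξ hξ
    choose γ hγ using (hflow ξ hξ).exists_tendsto_response hL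
    refine ⟨(n : ℝ)⁻¹ * ∑ l, γ l ^ 2, Tendsto.congr' ?_
      ((tendsto_finsetSum _ fun l _ => (hγ l).pow 2).const_mul _)⟩
    filter_upwards [eventually_ge_atTop 0] with t ht
    exact (hg ξ t ht).symm
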